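/- For an integer $m$ (positive or negative) and an integer $s\ge 1$ let $$L_m(s)=\sum_{l>0,\ l\ \mathrm{odd}}\left(\frac{-m}{l}\right)\frac1{l^{s}},$$ where $\left(\frac{-m}{l}\right)$ is the Jacobi symbol and the terms are summed in increasing order of $l$. For $m\ge 1$ put $K_m=\tfrac12$ if $m=1$ and $K_m=1$ otherwise, and $$c_{m,n}=(2n)!\,L_m(2n+1)(K_m\sqrt m)^{-1}\left(\frac{\pi}{2m}\right)^{-2n-1}\ (n\ge 0),\qquad d_{m,n}=(2n-1)!\,L_{-m}(2n)(K_m\sqrt m)^{-1}\left(\frac{\pi}{2m}\right)^{-2n}\ (n\ge 1).$$ Let $s_{m,n}=c_{m,n/2}$ for even $n$ and $s_{m,n}=d_{m,(n+1)/2}$ for odd $n$ (the generalized Euler and class numbers), and let $s_m(x)=\sum_{n\ge 0}s_{m,n}\frac{x^n}{n!}$. Theorem. Let $m=bu^2$, where $b\ge 1$ is square-free and $u>1$ is an integer, and put $w(b,t)=K_b\,t/u$. Then $s_m(x)$ is a linear combination, with all coefficients $0$ or $1$, of functions $$w(b,t)\sec(btx)\bigl(\pm\cos((b-p)tx)\pm\sin(ptx)\bigr),$$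 where $t$ is a positive divisor of $u^2$ and $p$ is an integer with $0\le p\le b$. More precisely, there are a finite set $T$ of pairs $(t,p)$ with $t\mid u^2$ and $0\le p\le b$, and signs $\varepsilon_{t,p},\delta_{t,p}\in\{1,-1\}$, such that for every real $x$ with $|x|<\frac{\pi}{2m}$ the series $s_m(x)$ converges and $$s_m(x)=\sum_{(t,p)\in T}w(b,t)\sec(btx)\bigl(\varepsilon_{t,p}\cos((b-p)tx)+\delta_{t,p}\sin(ptx)\bigr).$$ -/

import Mathlib

open Filter Topology

noncomputable section

namespace GenEulerClass

/-- Partial sums, over the odd numbers `l = 1, 3, …, 2 * N - 1`, of the Dirichlet series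
`∑ (-m / l) l ^ (-s)`, where `(-m / l)` is the Jacobi symbol. -/
def LPartial (m : ℤ) (s N : ℕ) : ℝ :=
  ∑ k ∈ Finset.range N, (jacobiSym (-m) (2 * k + 1) : ℝ) / ((2 * k + 1 : ℕ) : ℝ) ^ s

/-- The Dirichlet series `L_m(s) = ∑_{l > 0, l odd} (-m / l) l ^ (-s)` at a positive integer `s`.
It is the limit of the partial sums in increasing order of `l`, since the convergence at `s = 1`
is only conditional. -/
def L (m : ℤ) (s : ℕ) : ℝ :=
  limUnder atTop (LPartial m s)

/-- `K_m = 1 / 2` if `m = 1`, and `K_m = 1` otherwise. -/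
def K (m : ℕ) : ℝ := if m = 1 then 1 / 2 else 1

/-- `c_{m,n} = (2n)! L_m(2n+1) (K_m √m)⁻¹ (π / (2m)) ^ (-2n-1)`, for `n ≥ 0`. -/
def c (m n : ℕ) : ℝ :=
  ((2 * n).factorial : ℝ) * L (m : ℤ) (2 * n + 1) * (K m * √(m : ℝ))⁻¹ *
    ((Real.pi / (2 * (m : ℝ))) ^ (2 * n + 1))⁻¹

/-- `d_{m,n} = (2n-1)! L_{-m}(2n) (K_m √m)⁻¹ (π / (2m)) ^ (-2n)`; it is only used for `n ≥ 1`. -/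
def d (m n : ℕ) : ℝ :=
  ((2 * n - 1).factorial : ℝ) * L (-(m : ℤ)) (2 * n) * (K m * √(m : ℝ))⁻¹ *
    ((Real.pi / (2 * (m : ℝ))) ^ (2 * n))⁻¹

/-- The generalized Euler and class numbers `s_{m,n}`. -/
def s (m n : ℕ) : ℝ := if Even n then c m (n / 2) else d m ((n + 1) / 2)

/-- The terms of the exponential generating function of `(s_{m,n})_n`. -/
def sTerm (m : ℕ) (x : ℝ) (n : ℕ) : ℝ := s m n * x ^ n / (n.factorial : ℝ)

/-- The exponential generating function `s_m(x) = ∑_{n ≥ 0} s_{m,n} x ^ n / n!`. -/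
def sGen (m : ℕ) (x : ℝ) : ℝ := ∑' n, sTerm m x n

/-- The weight `w(b,t) = K_b t / u`. -/
def w (b u t : ℕ) : ℝ := K b * (t : ℝ) / (u : ℝ)

/-- The secant. -/
def sec (x : ℝ) : ℝ := (Real.cos x)⁻¹

/-- The function `w(b,t) sec(b t x) (ε cos((b - p) t x) + δ sin(p t x))`, with signs `ε, δ = ± 1`. -/
def term (b u t p : ℕ) (ε δ : ℤˣ) (x : ℝ) : ℝ :=
  w b u t * sec ((b : ℝ) * t * x) *
    (((ε : ℤ) : ℝ) * Real.cos (((b : ℝ) - p) * t * x) + ((δ : ℤ) : ℝ) * Real.sin ((p : ℝ) * t * x))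

end GenEulerClass

end

/-! The symbol (-bu²/l) is (-b/l) restricted to l coprime to u. Möbius inversion over the odd
divisors d of u therefore gives L_m(s) = L_b(s) ∑ μ(d)(-b/d) d^(-s), and similarly for L_{-m}. In
the generating function the factor d^(-s) rescales the variable, so each d contributes a copy of the
square-free answer with t = u²/d. Its coefficient is ±1 if d is square-free and coprime to b, and 0
otherwise (`tendsto_LPartial_mul_sq`, `hasSum_sTerm`).

For square-free b, a quadratic Gauss sum folded by its symmetries writes (-b/k), for odd k, as
(2K_b/√b) ∑ ± sin(kpπ/(2b)) over some 0 < p ≤ b (`exists_signs_jacobiSym_eq_sum_sin`). Only the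
square of the Gauss sum is needed: its sign is absorbed in the free signs of the theorem. For L_{-b}
one uses (b/(2k+1)) = (-1)^k (-b/(2k+1)).

What remains are the sums of sin((2k+1)θ)/(2k+1)^(2n+1) and of (-1)^k sin((2k+1)θ)/(2k+1)^(2n+2).
The Fourier series of an exponential sums their power series in z to (π/4) cos(z(π/2-θ))/cos(πz/2)
and (π/4) sin(zθ)/cos(πz/2). With θ = pπ/(2b) and z = 2btx/π these become the cosine and sine terms
over cos(btx). -/

open scoped NumberTheorySymbols

namespace GenEulerClass

/-! ### Fourier series of an exponential and its odd harmonics -/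

open Complex in
theorem summable_inv_sub_add_inv {y : ℝ} (hy : |y| < 1) :
    Summable (fun n : ℤ => ‖(1 / ((y : ℂ) - n) + 1 / (n : ℂ))‖) := by
  have h0 : Summable (fun n : ℤ => |y| / (1 - |y|) * (1 / (n : ℝ) ^ 2)) :=
    (Real.summable_one_div_int_pow.mpr one_lt_two).mul_left _
  refine Summable.of_norm_bounded_eventually h0 ?_
  filter_upwards [(Set.finite_singleton (0 : ℤ)).compl_mem_cofinite] with n hn
  have hn0 : n ≠ 0 := hn
  have hn1 : (1 : ℝ) ≤ |(n : ℝ)| := by exact_mod_cast Int.one_le_abs hn0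
  have hn' : (n : ℂ) ≠ 0 := by exact_mod_cast hn0
  have hge : |(n : ℝ)| * (1 - |y|) ≤ |y - n| := by
    have h1 : |(n : ℝ)| - |y| ≤ |y - n| := by
      rw [abs_sub_comm]; exact abs_sub_abs_le_abs_sub _ _
    nlinarith [abs_nonneg y]
  have hpos : 0 < |(n : ℝ)| * (1 - |y|) := mul_pos (by linarith) (by linarith)
  have hyn : (y : ℂ) - n ≠ 0 := by
    intro h
    have : y - n = 0 := by exact_mod_cast h
    rw [this, abs_zero] at hge
    linarith
  have he : 1 / ((y : ℂ) - n) + 1 / (n : ℂ) = ((y / ((y - n) * n) : ℝ) : ℂ) := by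
    push_cast; field_simp; ring
  rw [norm_norm, he, Complex.norm_real, Real.norm_eq_abs, abs_div, abs_mul, div_mul_div_comm,
    mul_one, ← sq_abs (n : ℝ)]
  have hn2 : 0 < |(n : ℝ)| := by linarith
  have : (1 - |y|) * |(n : ℝ)| ^ 2 ≤ |y - n| * |(n : ℝ)| := by nlinarith
  exact div_le_div_of_nonneg_left (abs_nonneg y) (by nlinarith) this

open Complex in
-- Subtracting a multiple of the first Bernoulli function removes the jump of the exponential at the
-- integers. The coefficients are then absolutely summable and the series converges pointwise.
theorem hasSum_fourier_exp_sub_linear {y : ℝ} (hy : |y| < 1) (hy0 : y ≠ 0) {t : ℝ}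
    (ht : t ∈ Set.Ico (0 : ℝ) 1) :
    HasSum (fun n : ℤ => (exp (2 * Real.pi * I * y) - 1) / (2 * Real.pi * I) *
        (1 / ((y : ℂ) - n) + 1 / (n : ℂ)) * exp (2 * Real.pi * I * n * t))
      (exp (2 * Real.pi * I * y * t) - (exp (2 * Real.pi * I * y) - 1) * (t - 1 / 2)) := by
  let E : ℝ → ℂ := fun t => exp (2 * Real.pi * I * y * t)
  let A : ℂ := exp (2 * Real.pi * I * y) - 1
  let f : ℝ → ℂ := fun t => E t - A * (bernoulliFun 1 t : ℂ)
  have hE : Continuous E := by fun_prop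
  have hB : Continuous fun t : ℝ => (bernoulliFun 1 t : ℂ) :=
    continuous_ofReal.comp (continuous_bernoulliFun 1)
  have hf : Continuous f := hE.sub (continuous_const.mul hB)
  -- The endpoints match: the exponential jumps by A over a period and `bernoulliFun 1` by 1.
  let F : C(AddCircle (1 : ℝ), ℂ) := ⟨AddCircle.liftIco 1 0 f,
    AddCircle.liftIco_zero_continuous (by
      simp only [f, E, A, bernoulliFun_one]; push_cast; simp; ring) hf.continuousOn⟩
  have hyn : ∀ n : ℤ, (y : ℂ) - n ≠ 0 := by
    intro n h
    have h1 : y - n = 0 := by exact_mod_cast h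
    have h2 : y = n := by linarith
    rw [h2] at hy hy0
    have : |n| < 1 := by exact_mod_cast hy
    rw [Int.abs_lt_one_iff] at this
    simp [this] at hy0
  have hpi : (2 * Real.pi * I : ℂ) ≠ 0 := two_pi_I_ne_zero
  have hc : ∀ n : ℤ, fourierCoeff F n =
      A / (2 * Real.pi * I) * (1 / ((y : ℂ) - n) + 1 / (n : ℂ)) := by
    intro n
    change fourierCoeff (AddCircle.liftIco 1 0 f) n = _
    rw [fourierCoeff_liftIco_eq]
    have hb := bernoulliFourierCoeff_eq one_ne_zero n
    rw [bernoulliFourierCoeff, fourierCoeffOn_eq_integral] at hb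
    rw [fourierCoeffOn_eq_integral]
    simp only [f, smul_sub]
    rw [intervalIntegral.integral_sub]
    rotate_left
    · exact Continuous.intervalIntegrable (by
        refine Continuous.smul (((fourier (-n)).continuous).comp (AddCircle.continuous_mk' _)) hE) _ _
    · exact Continuous.intervalIntegrable (by
        refine Continuous.smul (((fourier (-n)).continuous).comp (AddCircle.continuous_mk' _))
          (continuous_const.mul hB)) _ _
    have h1 : ∀ x : ℝ, fourier (-n) (x : AddCircle ((0 : ℝ) + 1 - 0)) • (A * (bernoulliFun 1 x : ℂ)) =
        A * (fourier (-n) (x : AddCircle ((0 : ℝ) + 1 - 0)) • (bernoulliFun 1 x : ℂ)) := by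
      intro x; simp only [smul_eq_mul]; ring
    simp_rw [h1]
    rw [intervalIntegral.integral_const_mul]
    have h2 : ∀ x : ℝ, fourier (-n) (x : AddCircle ((0 : ℝ) + 1 - 0)) • E x =
        exp ((2 * Real.pi * I * (y - n)) * x) := by
      intro x
      rw [fourier_coe_apply, smul_eq_mul, ← Complex.exp_add]
      congr 1
      push_cast; ring
    simp_rw [h2]
    rw [integral_exp_mul_complex (mul_ne_zero hpi (hyn n))]
    have h3 : exp (2 * Real.pi * I * (y - n) * ((0 + 1 : ℝ) : ℂ)) = A + 1 := by
      have : (2 * Real.pi * I * (y - n) * ((0 + 1 : ℝ) : ℂ)) =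
        2 * Real.pi * I * y - n * (2 * Real.pi * I) := by push_cast; ring
      rw [this, Complex.exp_sub, Complex.exp_int_mul_two_pi_mul_I]
      simp [A]
    rw [h3]
    norm_num at hb ⊢
    rw [hb]
    have := hyn n
    -- At n = 0 the convention 1/0 = 0 gives the right value, since the Bernoulli function has mean
    -- zero.
    by_cases hn : n = 0
    · subst hn
      simp at this ⊢
      field_simp
    · have : (n : ℂ) ≠ 0 := by exact_mod_cast hn
      field_simp
      ring
  have hs : Summable (fourierCoeff F) := by
    refine Summable.of_norm ?_
    simp_rw [hc, norm_mul]
    exact (summable_inv_sub_add_inv hy).mul_left _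
  have key := has_pointwise_sum_fourier_series_of_summable hs (t : AddCircle (1 : ℝ))
  simp_rw [hc] at key
  have hFt : F (t : AddCircle (1 : ℝ)) = f t := by
    change AddCircle.liftIco (1 : ℝ) 0 f t = f t
    exact AddCircle.liftIco_coe_apply (show t ∈ Set.Ico (0 : ℝ) (0 + 1) by rwa [zero_add])
  rw [hFt] at key
  convert! key using 2 with n
  · rw [smul_eq_mul, fourier_coe_apply]
    simp [A]
  · simp [A, bernoulliFun_one]

open Complex in
-- The difference of the previous series at t + 1/2 and at t kills the even frequencies and turns
-- the linear correction into a constant. Frequencies n and -n are then paired.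
theorem hasSum_odd_fourier_exp {y : ℝ} (hy : |y| < 1) (hy0 : y ≠ 0) {θ : ℝ}
    (h0 : 0 ≤ θ) (hπ : θ < Real.pi) :
    HasSum (fun k : ℕ =>
        (1 / ((y : ℂ) - (2 * k + 1)) + 1 / (2 * k + 1)) * exp ((2 * k + 1) * θ * I) +
        (1 / ((y : ℂ) + (2 * k + 1)) - 1 / (2 * k + 1)) * exp (-((2 * k + 1) * θ * I)))
      (-(Real.pi * I / 2) *
        (exp (y * (θ - Real.pi / 2) * I) / Real.cos (Real.pi * y / 2) - 1)) := by
  have hπ0 := Real.pi_pos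
  have hpi : (2 * Real.pi * I : ℂ) ≠ 0 := two_pi_I_ne_zero
  have hpi' : (Real.pi : ℂ) ≠ 0 := by exact_mod_cast hπ0.ne'
  have hcos : (cos (Real.pi * y / 2)) ≠ 0 := by
    have h := Real.cos_pos_of_mem_Ioo (x := Real.pi * y / 2)
      ⟨by nlinarith [neg_lt_of_abs_lt hy], by nlinarith [lt_of_abs_lt hy]⟩
    exact_mod_cast h.ne'
  obtain ⟨e, he⟩ : ∃ e : ℂ, e = exp (Real.pi * y / 2 * I) := ⟨_, rfl⟩
  have he0 : e ≠ 0 := he ▸ exp_ne_zero _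
  have he1 : exp (Real.pi * y * I) = e ^ 2 := by
    rw [he, ← exp_nat_mul]; congr 1; push_cast; ring
  have he2 : exp (2 * Real.pi * I * y) = e ^ 4 := by
    rw [he, ← exp_nat_mul]; congr 1; push_cast; ring
  have hcose : 2 * cos (Real.pi * y / 2) = e + e⁻¹ := by
    rw [Complex.cos, he, ← exp_neg, neg_mul]; ring
  have hA : e ^ 4 - 1 ≠ 0 := by
    rw [← he2, sub_ne_zero, Ne, Complex.exp_eq_one_iff]
    rintro ⟨n, hn⟩
    have h1 : (y : ℂ) = n := by
      apply mul_left_cancel₀ hpi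
      rw [hn]; ring
    have h2 : y = n := by exact_mod_cast h1
    rw [h2] at hy hy0
    have : |n| < 1 := by exact_mod_cast hy
    rw [Int.abs_lt_one_iff] at this
    simp [this] at hy0
  have hs1 := hasSum_fourier_exp_sub_linear hy hy0 (t := θ / (2 * Real.pi))
    ⟨by positivity, by rw [div_lt_one (by positivity)]; linarith⟩
  have hs2 := hasSum_fourier_exp_sub_linear hy hy0 (t := θ / (2 * Real.pi) + 1 / 2)
    ⟨by positivity, by
      have : θ / (2 * Real.pi) < 1 / 2 := by
        rw [div_lt_div_iff₀ (by positivity) (by positivity)]; linarith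
      linarith⟩
  have hs := ((hs2.sub hs1).mul_left (2 * Real.pi * I / (exp (2 * Real.pi * I * y) - 1))).mul_left
    (-1 / 2)
  rw [he2] at hs
  have hZ : ∀ n : ℤ, exp (2 * Real.pi * I * n * ((θ / (2 * Real.pi) : ℝ) : ℂ)) =
      exp (n * θ * I) := by
    intro n; congr 1; push_cast; field_simp
  have hZ' : ∀ n : ℤ, exp (2 * Real.pi * I * n * ((θ / (2 * Real.pi) + 1 / 2 : ℝ) : ℂ)) =
      exp (n * θ * I) * (-1) ^ n := by
    intro n
    rw [← exp_pi_mul_I, ← exp_int_mul, ← exp_add]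
    congr 1; push_cast; field_simp
  simp_rw [hZ, hZ'] at hs
  have hg := hs.nat_add_neg
  have hinj : Function.Injective (fun k : ℕ => 2 * k + 1) := fun a b h => by simpa using h
  have hg' := (hinj.hasSum_iff (by
    intro n hn
    have hev : Even n := by
      by_contra h
      obtain ⟨k, hk⟩ := Nat.not_even_iff_odd.mp h
      exact hn ⟨k, hk.symm⟩
    have e1 : ((-1 : ℂ)) ^ (n : ℤ) = 1 := by
      rw [zpow_natCast]; exact hev.neg_one_pow
    have e2 : ((-1 : ℂ)) ^ (-(n : ℤ)) = 1 := by rw [zpow_neg, e1, inv_one]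
    simp only [e1, e2]; ring)).mpr hg
  convert! hg' using 1
  · funext k
    have o1 : ((-1 : ℂ)) ^ ((2 * k + 1 : ℕ) : ℤ) = -1 := by
      rw [zpow_natCast]; exact (odd_two_mul_add_one k).neg_one_pow
    have o2 : ((-1 : ℂ)) ^ (-((2 * k + 1 : ℕ) : ℤ)) = -1 := by rw [zpow_neg, o1]; norm_num
    simp only [Function.comp_apply, o1, o2]
    push_cast
    have : (2 * (k : ℂ) + 1) ≠ 0 := by exact_mod_cast (by omega : 2 * k + 1 ≠ 0)
    have a1 : exp (-(2 * (k : ℂ) + 1) * θ * I) = exp (-((2 * k + 1) * θ * I)) := by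
      congr 1; ring
    have a2 : (y : ℂ) - -(2 * k + 1) = y + (2 * k + 1) := by ring
    have a3 : 1 / (-(2 * (k : ℂ) + 1)) = - (1 / (2 * k + 1)) := by rw [one_div, inv_neg, one_div]
    rw [a1, a2, a3]
    field_simp
    ring
  · have b1 : exp (2 * Real.pi * I * y * ((θ / (2 * Real.pi) : ℝ) : ℂ)) = exp (y * θ * I) := by
      congr 1; push_cast; field_simp
    have b2 : exp (2 * Real.pi * I * y * ((θ / (2 * Real.pi) + 1 / 2 : ℝ) : ℂ)) =
        exp (y * θ * I) * e ^ 2 := by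
      rw [← he1, ← exp_add]; congr 1; push_cast; field_simp
    have b3 : exp (y * (θ - Real.pi / 2) * I) = exp (y * θ * I) * e⁻¹ := by
      rw [he, ← exp_neg, ← exp_add]; congr 1; ring
    have b4 : ((Real.cos (Real.pi * y / 2) : ℝ) : ℂ) = (e + e⁻¹) / 2 := by
      rw [← hcose]; push_cast; ring
    have b5 : e ^ 2 + 1 ≠ 0 := by
      intro h
      apply hcos
      have : 2 * cos (Real.pi * y / 2) = 0 := by
        rw [hcose]; field_simp; simpa using h
      simpa using this
    have b6 : e ^ 2 - 1 ≠ 0 := fun h => hA (by linear_combination (e ^ 2 + 1) * h)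
    rw [b1, b2, b3, b4]
    have b7 : e ^ 4 - 1 = (e ^ 2 + 1) * (e ^ 2 - 1) := by ring
    rw [b7]
    push_cast
    simp
    field_simp
    ring

theorem odd_sq_sub_sq_pos {y : ℝ} (hy : |y| < 1) (k : ℕ) :
    0 < (2 * k + 1 : ℝ) ^ 2 - y ^ 2 := by
  have h1 : y ^ 2 < 1 := by rw [← sq_abs]; nlinarith [abs_nonneg y]
  have h2 : (0 : ℝ) ≤ k := Nat.cast_nonneg k
  nlinarith

open Complex in
-- Real and imaginary parts of the odd expansion; y = 0, excluded there, is trivial here.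
theorem hasSum_odd_exp_parts {y : ℝ} (hy : |y| < 1) {θ : ℝ} (h0 : 0 ≤ θ) (hπ : θ < Real.pi) :
    HasSum (fun k : ℕ => y / ((2 * k + 1 : ℝ) ^ 2 - y ^ 2) * Real.cos ((2 * k + 1) * θ))
      (Real.pi / 4 * (Real.sin (y * (Real.pi / 2 - θ)) / Real.cos (Real.pi * y / 2))) ∧
    HasSum (fun k : ℕ => y ^ 2 / ((2 * k + 1 : ℝ) * ((2 * k + 1 : ℝ) ^ 2 - y ^ 2)) *
        Real.sin ((2 * k + 1) * θ))
      (Real.pi / 4 * (Real.cos (y * (Real.pi / 2 - θ)) / Real.cos (Real.pi * y / 2) - 1)) := by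
  rcases eq_or_ne y 0 with rfl | hy0
  · simp [hasSum_zero]
  have key := hasSum_odd_fourier_exp hy hy0 h0 hπ
  have hterm : ∀ k : ℕ,
      (1 / ((y : ℂ) - (2 * k + 1)) + 1 / (2 * k + 1)) * exp ((2 * k + 1) * θ * I) +
        (1 / ((y : ℂ) + (2 * k + 1)) - 1 / (2 * k + 1)) * exp (-((2 * k + 1) * θ * I)) =
      ((-2 * (y / ((2 * k + 1 : ℝ) ^ 2 - y ^ 2) * Real.cos ((2 * k + 1) * θ)) : ℝ) : ℂ) +
      ((-2 * (y ^ 2 / ((2 * k + 1 : ℝ) * ((2 * k + 1 : ℝ) ^ 2 - y ^ 2)) *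
        Real.sin ((2 * k + 1) * θ)) : ℝ) : ℂ) * I := by
    intro k
    have hd := (odd_sq_sub_sq_pos hy k).ne'
    have hd' : ((2 * k + 1 : ℂ) ^ 2 - (y : ℂ) ^ 2) ≠ 0 := by exact_mod_cast hd
    have d1 : (y : ℂ) - (2 * k + 1) ≠ 0 := fun h =>
      hd' (by linear_combination -(2 * (k : ℂ) + 1 + y) * h)
    have d2 : (y : ℂ) + (2 * k + 1) ≠ 0 := fun h =>
      hd' (by linear_combination (2 * (k : ℂ) + 1 - y) * h)
    have d3 : (2 * (k : ℂ) + 1) ≠ 0 := by exact_mod_cast (by omega : 2 * k + 1 ≠ 0)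
    have e1 : exp ((2 * k + 1) * θ * I) = cos ((2 * k + 1) * θ) + sin ((2 * k + 1) * θ) * I :=
      exp_mul_I _
    have e2 : exp (-((2 * k + 1) * θ * I)) = cos ((2 * k + 1) * θ) - sin ((2 * k + 1) * θ) * I := by
      rw [← neg_mul, exp_mul_I, cos_neg, sin_neg]; ring
    rw [e1, e2]
    push_cast
    have f1 : 1 / ((y : ℂ) - (2 * k + 1)) = -((y + (2 * k + 1)) / ((2 * k + 1 : ℂ) ^ 2 - y ^ 2)) := by
      field_simp; ring
    have f2 : 1 / ((y : ℂ) + (2 * k + 1)) = -((y - (2 * k + 1)) / ((2 * k + 1 : ℂ) ^ 2 - y ^ 2)) := by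
      field_simp; ring
    rw [f1, f2]
    field_simp
    ring
  simp_rw [hterm] at key
  have hval : -(Real.pi * I / 2) *
        (exp (y * (θ - Real.pi / 2) * I) / Real.cos (Real.pi * y / 2) - 1) =
      ((-2 * (Real.pi / 4 * (Real.sin (y * (Real.pi / 2 - θ)) / Real.cos (Real.pi * y / 2))) : ℝ) : ℂ)
      + ((-2 * (Real.pi / 4 * (Real.cos (y * (Real.pi / 2 - θ)) / Real.cos (Real.pi * y / 2) - 1)) :
        ℝ) : ℂ) * I := by
    have e1 : exp (y * (θ - Real.pi / 2) * I) =
        cos (y * (Real.pi / 2 - θ)) - sin (y * (Real.pi / 2 - θ)) * I := by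
      rw [exp_mul_I]
      have : (y : ℂ) * (θ - Real.pi / 2) = -(y * (Real.pi / 2 - θ)) := by ring
      rw [this, cos_neg, sin_neg]; ring
    rw [e1]
    push_cast
    linear_combination (Real.pi / 2 * sin (y * (Real.pi / 2 - θ)) / cos (Real.pi * y / 2)) * I_mul_I
  rw [hval] at key
  have hre := (Complex.hasSum_re key).mul_left (-1 / 2)
  have him := (Complex.hasSum_im key).mul_left (-1 / 2)
  simp only [add_re, ofReal_re, re_ofReal_mul, I_re, mul_zero, add_zero, add_im, ofReal_im,
    im_ofReal_mul, I_im, mul_one, zero_add, ← mul_assoc] at hre him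
  norm_num at hre him
  constructor
  · simpa [mul_assoc] using hre
  · simpa [mul_assoc] using him

/-! ### The conditionally convergent sine series -/

theorem two_mul_sin_mul_sum_cos_odd (t : ℝ) (N : ℕ) :
    2 * Real.sin t * ∑ k ∈ Finset.range N, Real.cos ((2 * k + 1) * t) = Real.sin (2 * N * t) := by
  induction N with
  | zero => simp
  | succ N ih =>
    rw [Finset.sum_range_succ, mul_add, ih]
    have h1 : 2 * ((N + 1 : ℕ) : ℝ) * t = (2 * N + 1) * t + t := by push_cast; ring
    have h2 : 2 * (N : ℝ) * t = (2 * N + 1) * t - t := by ring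
    rw [h1, h2, Real.sin_add, Real.sin_sub]
    ring

theorem tendsto_integral_sin_two_mul_div_sin {a b : ℝ} (ha : 0 < a) (hab : a ≤ b)
    (hb : b < Real.pi) :
    Tendsto (fun N : ℕ => ∫ t in a..b, Real.sin (2 * N * t) * (2 * Real.sin t)⁻¹) atTop (𝓝 0) := by
  have hcont : ContinuousOn (fun t : ℝ => (2 * Real.sin t)⁻¹) (Set.uIcc a b) := by
    refine ContinuousOn.inv₀ (by fun_prop) ?_
    intro x hx
    rw [Set.uIcc_of_le hab] at hx
    have := Real.sin_pos_of_pos_of_lt_pi (lt_of_lt_of_le ha hx.1) (lt_of_le_of_lt hx.2 hb)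
    positivity
  let g : ℝ → ℂ := Set.indicator (Set.Ioc a b) (fun t => (((2 * Real.sin t)⁻¹ : ℝ) : ℂ))
  have h1 := Real.tendsto_integral_exp_smul_cocompact g
  -- Riemann–Lebesgue at frequency N/π: the Fourier kernel is exp(-2iNt), with imaginary part
  -- -sin(2Nt).
  have h2 : Tendsto (fun N : ℕ => (N : ℝ) / Real.pi) atTop (cocompact ℝ) :=
    (tendsto_natCast_atTop_atTop.atTop_div_const Real.pi_pos).mono_right
      atTop_le_cocompact
  have h3 := (Complex.continuous_im.tendsto _).comp (h1.comp h2)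
  have h4 := h3.neg
  rw [Complex.zero_im, neg_zero] at h4
  refine h4.congr fun N => ?_
  simp only [Function.comp_apply]
  have h5 : ∀ v : ℝ, Real.fourierChar (-(v * (N / Real.pi))) • g v =
      Set.indicator (Set.Ioc a b) (fun t : ℝ => Complex.exp (-(2 * N * t : ℝ) * Complex.I) *
        (((2 * Real.sin t)⁻¹ : ℝ) : ℂ)) v := by
    intro v
    by_cases hv : v ∈ Set.Ioc a b
    · simp only [g, Set.indicator_of_mem hv]
      rw [Circle.smul_def, Real.fourierChar_apply, smul_eq_mul]
      congr 2
      have := Real.pi_ne_zero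
      push_cast
      field_simp
    · simp only [g, Set.indicator_of_notMem hv, smul_zero]
  simp_rw [h5]
  rw [MeasureTheory.integral_indicator measurableSet_Ioc, ← intervalIntegral.integral_of_le hab]
  have h6 := Complex.imCLM.intervalIntegral_comp_comm (μ := MeasureTheory.volume) (a := a) (b := b)
    (f := fun t : ℝ => Complex.exp (-(2 * N * t : ℝ) * Complex.I) *
        (((2 * Real.sin t)⁻¹ : ℝ) : ℂ)) (by
      apply ContinuousOn.intervalIntegrable
      refine ContinuousOn.mul (by fun_prop) ?_
      exact Complex.continuous_ofReal.comp_continuousOn hcont)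
  simp only [Complex.imCLM_apply] at h6
  rw [← h6, ← intervalIntegral.integral_neg]
  congr 1
  funext t
  rw [Complex.im_mul_ofReal, ← Complex.ofReal_neg, Complex.exp_ofReal_mul_I_im, Real.sin_neg]
  ring

/-- The partial sum at θ differs from that at π/2, a Leibniz partial sum, by the integral of its
derivative sin(2Nt)/(2 sin t), which tends to 0. -/
theorem tendsto_sum_sin_odd_div {θ : ℝ} (h0 : 0 < θ) (hθ : θ ≤ Real.pi / 2) :
    Tendsto (fun N : ℕ => ∑ k ∈ Finset.range N, Real.sin ((2 * k + 1) * θ) / (2 * k + 1)) atTop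
      (𝓝 (Real.pi / 4)) := by
  have hπ := Real.pi_pos
  have h1 := tendsto_integral_sin_two_mul_div_sin h0 hθ (by linarith)
  have h2 := Real.tendsto_sum_pi_div_four.sub h1
  rw [sub_zero] at h2
  refine h2.congr fun N => ?_
  have hder : ∀ x ∈ Set.uIcc θ (Real.pi / 2),
      HasDerivAt (fun x => ∑ k ∈ Finset.range N, Real.sin ((2 * k + 1) * x) / (2 * k + 1))
        (Real.sin (2 * N * x) * (2 * Real.sin x)⁻¹) x := by
    intro x hx
    rw [Set.uIcc_of_le hθ] at hx
    have hs := Real.sin_pos_of_pos_of_lt_pi (lt_of_lt_of_le h0 hx.1) (by linarith [hx.2])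
    have : Real.sin (2 * N * x) * (2 * Real.sin x)⁻¹ =
        ∑ k ∈ Finset.range N, Real.cos ((2 * k + 1) * x) := by
      rw [← two_mul_sin_mul_sum_cos_odd, mul_comm (2 * Real.sin x), mul_assoc,
        mul_inv_cancel₀ (by positivity), mul_one]
    rw [this]
    refine HasDerivAt.fun_sum fun k _ => ?_
    have hk : (2 * (k : ℝ) + 1) ≠ 0 := by positivity
    have := (((hasDerivAt_id x).const_mul (2 * (k : ℝ) + 1)).sin).div_const (2 * (k : ℝ) + 1)
    convert! this using 1
    simp [hk]
  rw [intervalIntegral.integral_eq_sub_of_hasDerivAt hder]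
  · have : ∀ k : ℕ, Real.sin ((2 * k + 1) * (Real.pi / 2)) = (-1) ^ k := by
      intro k
      have : (2 * (k : ℝ) + 1) * (Real.pi / 2) = Real.pi / 2 + k * Real.pi := by ring
      rw [this, Real.sin_add_nat_mul_pi, Real.sin_pi_div_two, mul_one]
    simp_rw [this]
    ring
  · apply ContinuousOn.intervalIntegrable
    refine ContinuousOn.mul (by fun_prop) (ContinuousOn.inv₀ (by fun_prop) ?_)
    intro x hx
    rw [Set.uIcc_of_le hθ] at hx
    have := Real.sin_pos_of_pos_of_lt_pi (lt_of_lt_of_le h0 hx.1) (by linarith [hx.2])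
    positivity

/-! ### Power series whose coefficients are odd Dirichlet sums -/

theorem summable_one_div_odd_sq : Summable (fun k : ℕ => 1 / (2 * (k : ℝ) + 1) ^ 2) := by
  have h := (Real.summable_one_div_nat_pow.mpr one_lt_two).comp_injective
    (i := fun k : ℕ => 2 * k + 1) (fun a b h => by simpa using h)
  exact h.congr fun k => by simp

theorem summable_div_odd_pow {c : ℕ → ℝ} (hc : ∀ k, |c k| ≤ 1) {j : ℕ} (hj : 2 ≤ j) :
    Summable (fun k : ℕ => c k / (2 * (k : ℝ) + 1) ^ j) := by
  refine Summable.of_norm_bounded summable_one_div_odd_sq fun k => ?_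
  have h1 : (1 : ℝ) ≤ 2 * k + 1 := by have := Nat.cast_nonneg (α := ℝ) k; linarith
  rw [Real.norm_eq_abs, abs_div, abs_of_pos (by positivity : (0 : ℝ) < (2 * (k : ℝ) + 1) ^ j)]
  exact div_le_div₀ zero_le_one (hc k) (by positivity) (pow_le_pow_right₀ h1 hj)

/-- Each summand is a geometric series in z²/(2k+1)², and the double series converges absolutely.
The cases i = 0 and i = 1 serve the cosine and sine expansions. -/
theorem hasSum_tsum_div_odd_pow_mul_pow {c : ℕ → ℝ} (hc : ∀ k, |c k| ≤ 1) {z : ℝ} (hz : |z| < 1)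
    (i : ℕ) {G : ℝ}
    (h : HasSum (fun k : ℕ => z ^ (i + 1) / ((2 * (k : ℝ) + 1) ^ i * ((2 * k + 1) ^ 2 - z ^ 2)) *
      c k) G) :
    HasSum (fun n : ℕ => (∑' k : ℕ, c k / (2 * (k : ℝ) + 1) ^ (2 * n + i + 2)) *
      z ^ (2 * n + i + 1)) G := by
  have hz2 : z ^ 2 < 1 := by rw [← sq_abs]; nlinarith [abs_nonneg z]
  let a : ℕ × ℕ → ℝ := fun p =>
    c p.2 / (2 * (p.2 : ℝ) + 1) ^ (2 * p.1 + i + 2) * z ^ (2 * p.1 + i + 1)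
  have ha : Summable a := by
    have hgeo : Summable (fun n : ℕ => (z ^ 2) ^ n) :=
      summable_geometric_of_lt_one (sq_nonneg z) hz2
    refine Summable.of_norm_bounded (hgeo.mul_of_nonneg summable_one_div_odd_sq
      (fun n => by positivity) (fun k => by positivity)) fun p => ?_
    obtain ⟨n, k⟩ := p
    have h1 : (1 : ℝ) ≤ 2 * k + 1 := by have := Nat.cast_nonneg (α := ℝ) k; linarith
    simp only [a]
    rw [Real.norm_eq_abs, abs_mul, abs_div, mul_comm,
      abs_of_pos (by positivity : (0 : ℝ) < (2 * (k : ℝ) + 1) ^ (2 * n + i + 2)), abs_pow]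
    refine mul_le_mul ?_ ?_ (by positivity) (by positivity)
    · rw [← sq_abs, ← pow_mul]
      exact pow_le_pow_of_le_one (abs_nonneg z) hz.le (by omega)
    · exact div_le_div₀ zero_le_one (hc k) (by positivity) (pow_le_pow_right₀ h1 (by omega))
  have hk : ∀ k : ℕ, HasSum (fun n : ℕ => a (n, k))
      (z ^ (i + 1) / ((2 * (k : ℝ) + 1) ^ i * ((2 * k + 1) ^ 2 - z ^ 2)) * c k) := by
    intro k
    have h1 : (1 : ℝ) ≤ 2 * k + 1 := by have := Nat.cast_nonneg (α := ℝ) k; linarith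
    have hd := odd_sq_sub_sq_pos hz k
    have hr : z ^ 2 / (2 * (k : ℝ) + 1) ^ 2 < 1 := by
      rw [div_lt_one (by positivity)]; linarith
    have hg := (hasSum_geometric_of_lt_one (by positivity) hr).mul_left
      (c k * z ^ (i + 1) / (2 * (k : ℝ) + 1) ^ (i + 2))
    convert! hg using 1
    · funext n
      simp only [a]
      rw [div_pow, ← pow_mul, ← pow_mul]
      have e1 : 2 * n + i + 2 = (i + 2) + 2 * n := by ring
      have e2 : 2 * n + i + 1 = (i + 1) + 2 * n := by ring
      rw [e1, e2, pow_add, pow_add z]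
      field_simp
    · have e : (1 : ℝ) - z ^ 2 / (2 * k + 1) ^ 2 =
          ((2 * k + 1) ^ 2 - z ^ 2) / (2 * k + 1) ^ 2 := by
        field_simp
      rw [e, inv_div, pow_add _ i 2]
      have := hd.ne'
      field_simp
  have hswap := (ha.prod_symm.hasSum).prod_fiberwise (fun k => hk k)
  have hG : ∑' p : ℕ × ℕ, a p.swap = G := hswap.unique h
  have htot : HasSum a G := by
    have := ha.hasSum
    rwa [← (Equiv.prodComm ℕ ℕ).tsum_eq a, show (∑' p, a (Equiv.prodComm ℕ ℕ p)) = G from hG] at this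
  refine htot.prod_fiberwise fun n => ?_
  simp only [a]
  exact ((summable_div_odd_pow hc (by omega)).hasSum).mul_right _

theorem exists_tendsto_sum_sin_odd_hasSum {θ : ℝ} (h0 : 0 < θ) (hθ : θ ≤ Real.pi / 2) :
    ∃ S : ℕ → ℝ,
      (∀ n, Tendsto (fun N : ℕ => ∑ k ∈ Finset.range N,
        Real.sin ((2 * k + 1) * θ) / (2 * (k : ℝ) + 1) ^ (2 * n + 1)) atTop (𝓝 (S n))) ∧
      ∀ z : ℝ, |z| < 1 → HasSum (fun n => S n * z ^ (2 * n))
        (Real.pi / 4 * (Real.cos (z * (Real.pi / 2 - θ)) / Real.cos (Real.pi * z / 2))) := by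
  have hπ := Real.pi_pos
  have hc : ∀ k : ℕ, |Real.sin ((2 * k + 1) * θ)| ≤ 1 := fun k => Real.abs_sin_le_one _
  -- The term n = 0 is set apart: its series need not converge absolutely, so `tsum` cannot be
  -- relied on.
  refine ⟨fun n => if n = 0 then Real.pi / 4 else
    ∑' k : ℕ, Real.sin ((2 * k + 1) * θ) / (2 * (k : ℝ) + 1) ^ (2 * n + 1), fun n => ?_,
    fun z hz => ?_⟩
  · rcases Nat.eq_zero_or_pos n with rfl | hn
    · simpa using tendsto_sum_sin_odd_div h0 hθ
    · simp only [if_neg hn.ne']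
      exact (summable_div_odd_pow hc (by omega)).hasSum.tendsto_sum_nat
  · have h := (hasSum_odd_exp_parts hz h0.le (by linarith)).2
    have h' := hasSum_tsum_div_odd_pow_mul_pow hc hz 1 (by simpa using h)
    rw [← hasSum_nat_add_iff' 1]
    convert! h' using 1
    simp
    ring

theorem exists_hasSum_alternating_sin_odd {φ : ℝ} (h0 : 0 ≤ φ) (hφ : φ ≤ Real.pi / 2) :
    ∃ S : ℕ → ℝ,
      (∀ n, Tendsto (fun N : ℕ => ∑ k ∈ Finset.range N,
        (-1) ^ k * Real.sin ((2 * k + 1) * φ) / (2 * (k : ℝ) + 1) ^ (2 * n + 2)) atTop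
        (𝓝 (S n))) ∧
      ∀ z : ℝ, |z| < 1 → HasSum (fun n => S n * z ^ (2 * n + 1))
        (Real.pi / 4 * (Real.sin (z * φ) / Real.cos (Real.pi * z / 2))) := by
  have hπ := Real.pi_pos
  have hc : ∀ k : ℕ, |(-1) ^ k * Real.sin ((2 * k + 1) * φ)| ≤ 1 := fun k => by
    rw [abs_mul, abs_pow, abs_neg, abs_one, one_pow, one_mul]; exact Real.abs_sin_le_one _
  refine ⟨fun n => ∑' k : ℕ, (-1) ^ k * Real.sin ((2 * k + 1) * φ) /
    (2 * (k : ℝ) + 1) ^ (2 * n + 2), fun n => ?_, fun z hz => ?_⟩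
  · exact (summable_div_odd_pow hc (by omega)).hasSum.tendsto_sum_nat
  -- At the complementary angle the cosines become alternating sines.
  · have h := (hasSum_odd_exp_parts hz (θ := Real.pi / 2 - φ) (by linarith) (by linarith)).1
    have e : ∀ k : ℕ, Real.cos ((2 * k + 1) * (Real.pi / 2 - φ)) =
        (-1) ^ k * Real.sin ((2 * k + 1) * φ) := by
      intro k
      have : (2 * (k : ℝ) + 1) * (Real.pi / 2 - φ) =
        (Real.pi / 2 - (2 * k + 1) * φ) + k * Real.pi := by ring
      rw [this, Real.cos_add_nat_mul_pi, Real.cos_pi_div_two_sub]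
    simp_rw [e, sub_sub_cancel] at h
    exact hasSum_tsum_div_odd_pow_mul_pow hc hz 0 (by simpa using h)

/-! ### Gauss sums of odd real primitive characters -/

/-- A conductor smaller than N divides N/q for some prime q, so the character would be 1 on units
congruent to 1 modulo N/q. -/
theorem isPrimitive_of_forall_prime {N : ℕ} [NeZero N] (χ : DirichletCharacter ℂ N)
    (h : ∀ q : ℕ, q.Prime → q ∣ N → ∃ a : ℕ, a ≡ 1 [MOD N / q] ∧ χ a = -1) : χ.IsPrimitive := by
  rw [DirichletCharacter.isPrimitive_def]
  by_contra hne
  obtain ⟨r, hr⟩ := χ.conductor_dvd_level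
  have hr1 : r ≠ 1 := by rintro rfl; exact hne (by simpa using hr.symm)
  obtain ⟨q, hq, t, rfl⟩ := Nat.exists_prime_and_dvd hr1
  have hqN : q ∣ N := ⟨χ.conductor * t, hr.trans (by ring)⟩
  have hNq : N / q = χ.conductor * t := by
    rw [Nat.div_eq_iff_eq_mul_left hq.pos hqN]; linarith
  obtain ⟨a, ha, hχ⟩ := h q hq hqN
  have hdvd : N / q ∣ N := Nat.div_dvd_of_dvd hqN
  have hf : χ.FactorsThrough (N / q) :=
    χ.factorsThrough_conductor.mono χ (by rw [hNq]; exact dvd_mul_right _ _) hdvd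
  rw [DirichletCharacter.factorsThrough_iff_ker_unitsMap hdvd] at hf
  have hau : IsUnit (a : ZMod N) := by
    by_contra hu
    rw [χ.map_nonunit hu] at hχ
    norm_num at hχ
  have hker : hau.unit ∈ (ZMod.unitsMap hdvd).ker := by
    rw [MonoidHom.mem_ker]
    ext
    rw [ZMod.unitsMap_val]
    simp only [IsUnit.unit_spec, Units.val_one, ZMod.cast_natCast hdvd]
    exact_mod_cast (ZMod.natCast_eq_natCast_iff _ _ _).mpr ha
  have h1 := hf hker
  rw [MonoidHom.mem_ker] at h1
  have h2 : χ (a : ZMod N) = 1 := by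
    rw [χ.toUnitHom_eq_char' hau, h1]; rfl
  rw [h2] at hχ
  norm_num at hχ

theorem sum_zmod_eq_sum_range {N : ℕ} [NeZero N] {M : Type*} [AddCommMonoid M] (F : ZMod N → M) :
    ∑ j : ZMod N, F j = ∑ j ∈ Finset.range N, F (j : ZMod N) := by
  symm
  refine Finset.sum_bij' (fun j _ => (j : ZMod N)) (fun j _ => j.val) (fun _ _ => Finset.mem_univ _)
    (fun j _ => Finset.mem_range.mpr (ZMod.val_lt j)) ?_ ?_ (fun _ _ => rfl)
  · intro j hj
    exact ZMod.val_cast_of_lt (Finset.mem_range.mp hj)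
  · intro j _
    exact ZMod.natCast_zmod_val j

open ZMod DirichletCharacter in
-- For a real odd primitive character, applying the discrete Fourier transform twice gives τ² = -N,
-- so τ = ±i√N. The imaginary part of the transform is the sine sum.
theorem exists_sign_sum_quadratic_mul_sin {N : ℕ} [NeZero N] (g : ℕ → ℤ)
    (hper : ∀ l, g (l % N) = g l) (hone : g 1 = 1) (hmul : ∀ k l, g (k * l) = g k * g l)
    (hzero : ∀ l, ¬ l.Coprime N → g l = 0) (hsq : ∀ l, g l = 0 ∨ g l = 1 ∨ g l = -1)
    (hneg : g (N - 1) = -1)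
    (hprim : ∀ q : ℕ, q.Prime → q ∣ N → ∃ a : ℕ, a ≡ 1 [MOD N / q] ∧ g a = -1) :
    ∃ σ : ℤˣ, ∀ k : ℕ, ∑ j ∈ Finset.range N, (g j : ℝ) * Real.sin (2 * Real.pi * (j * k) / N) =
      ((σ : ℤ) : ℝ) * √(N : ℝ) * g k := by
  have hN : 0 < N := Nat.pos_of_ne_zero (NeZero.ne N)
  let χ : DirichletCharacter ℂ N :=
    { toFun := fun a => (g a.val : ℂ)
      map_one' := by
        have : g (1 : ZMod N).val = g 1 := by
          rw [← hper 1, ← ZMod.val_natCast, Nat.cast_one]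
        rw [this, hone, Int.cast_one]
      map_mul' := fun a b => by rw [ZMod.val_mul, hper, hmul, Int.cast_mul]
      map_nonunit' := fun a ha => by
        change (g a.val : ℂ) = 0
        rw [hzero, Int.cast_zero]
        intro hc
        apply ha
        rw [← ZMod.natCast_zmod_val a]
        exact (ZMod.isUnit_iff_coprime _ _).mpr hc }
  have hχ : ∀ l : ℕ, χ (l : ZMod N) = g l := fun l => by
    change (g (l : ZMod N).val : ℂ) = g l
    rw [ZMod.val_natCast, hper]
  have hχ' : ∀ a : ZMod N, χ a = g a.val := fun a => rfl
  have hp : χ.IsPrimitive := isPrimitive_of_forall_prime χ fun q hq hqN => by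
    obtain ⟨a, ha, h⟩ := hprim q hq hqN
    exact ⟨a, ha, by rw [hχ, h]; norm_num⟩
  have hinv : χ⁻¹ = χ := by
    ext a
    rw [MulChar.inv_apply_eq_inv' χ (a : ZMod N), hχ']
    rcases hsq (a : ZMod N).val with h | h | h <;> rw [h] <;> norm_num
  have hodd : χ (-1) = -1 := by
    have : (-1 : ZMod N) = ((N - 1 : ℕ) : ZMod N) := by
      rw [Nat.cast_sub hN]; simp
    rw [this, hχ, hneg]; norm_num
  have hoddf : ∀ a, χ (-a) = -χ a := fun a => by
    rw [← neg_one_mul, map_mul, hodd, neg_one_mul]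
  obtain ⟨τ, hτ⟩ : ∃ τ, τ = gaussSum χ stdAddChar := ⟨_, rfl⟩
  have hF : ∀ k : ZMod N, 𝓕 (χ : ZMod N → ℂ) k = -τ * χ k := fun k => by
    rw [hp.fourierTransform_eq_inv_mul_gaussSum, hinv, hoddf, hτ]; ring
  have hτ2 : τ ^ 2 = -(N : ℂ) := by
    -- The double transform at 1 is τ² on one side and N χ(-1) = -N on the other.
    have h1 := congrFun (dft_dft (χ : ZMod N → ℂ)) 1
    have h2 : 𝓕 (χ : ZMod N → ℂ) = fun k => -τ * χ k := funext hF
    rw [h2, dft_const_mul] at h1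
    simp only [hF, hodd, map_one, smul_eq_mul] at h1
    linear_combination h1
  have hsqrt : ((√(N : ℝ) : ℝ) : ℂ) ^ 2 = N := by
    rw [← Complex.ofReal_pow, Real.sq_sqrt (Nat.cast_nonneg N)]; simp
  have hτ3 : ∃ σ : ℤˣ, τ = (((σ : ℤ) : ℝ) * √(N : ℝ) : ℝ) * Complex.I := by
    have : (τ - √(N : ℝ) * Complex.I) * (τ + √(N : ℝ) * Complex.I) = 0 := by
      linear_combination hτ2 + hsqrt - ((√(N : ℝ) : ℝ) : ℂ) ^ 2 * Complex.I_sq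
    rcases mul_eq_zero.mp this with h | h
    · exact ⟨1, by simpa using sub_eq_zero.mp h⟩
    · exact ⟨-1, by simpa using eq_neg_of_add_eq_zero_left h⟩
  obtain ⟨σ, hσ⟩ := hτ3
  refine ⟨σ, fun k => ?_⟩
  have h1 := hF (k : ZMod N)
  rw [dft_apply, sum_zmod_eq_sum_range, hσ, hχ] at h1
  have h2 := congrArg Complex.im h1
  rw [Complex.im_sum] at h2
  have h3 : ∀ j : ℕ, (stdAddChar (-((j : ZMod N) * (k : ZMod N))) • χ (j : ZMod N)).im =
      -((g j : ℝ) * Real.sin (2 * Real.pi * (j * k) / N)) := by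
    intro j
    have e1 : (-((j : ZMod N) * (k : ZMod N))) = ((-(j * k : ℤ) : ℤ) : ZMod N) := by push_cast; ring
    have e2 : (2 * Real.pi * Complex.I * ((-(j * k : ℤ) : ℤ) : ℂ) / N : ℂ) =
        ((-(2 * Real.pi * (j * k) / N) : ℝ) : ℂ) * Complex.I := by push_cast; ring
    rw [e1, stdAddChar_coe, hχ, e2, smul_eq_mul, ← Complex.ofReal_intCast, Complex.im_mul_ofReal,
      Complex.exp_ofReal_mul_I_im, Real.sin_neg]
    ring
  simp_rw [h3] at h2
  rw [Finset.sum_neg_distrib] at h2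
  have e3 : (-((((σ : ℤ) : ℝ) * √(N : ℝ) : ℝ) * Complex.I) * (g k : ℂ)).im =
      -(((σ : ℤ) : ℝ) * √(N : ℝ) * g k) := by
    rw [← Complex.ofReal_intCast (g k), Complex.im_mul_ofReal]
    simp
  rw [e3] at h2
  exact neg_injective h2

/-! ### Residue symbols and folding of finite sums -/

theorem exists_jacobiSym_eq_neg_one {q : ℕ} (hq : q.Prime) (hq2 : q ≠ 2) :
    ∃ n : ℕ, J(n | q) = -1 := by
  have := Fact.mk hq
  obtain ⟨a, ha⟩ := FiniteField.exists_nonsquare (F := ZMod q) (by rwa [ZMod.ringChar_zmod_n])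
  refine ⟨a.val, ?_⟩
  rw [← jacobiSym.legendreSym.to_jacobiSym, legendreSym.eq_neg_one_iff]
  simpa using ha

theorem jacobiSym_neg_eq_one_of_modEq_one {c a : ℕ} (ha : a ≡ 1 [MOD 4 * c]) : J(-c | a) = 1 := by
  have h4 : a % 4 = 1 := (Nat.ModEq.of_mul_right c ha)
  have hodd : Odd a := Nat.odd_iff.mpr (by omega)
  have h1 := jacobiSym.mod_right (-c) odd_one
  rw [Int.natAbs_neg, Int.natAbs_natCast, jacobiSym.one_right] at h1
  rw [jacobiSym.mod_right _ hodd, Int.natAbs_neg, Int.natAbs_natCast, ha, ← h1]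

theorem modEq_and_jacobiSym_eq_neg_one {q c : ℕ} (hq : q.Prime) (hq2 : q ≠ 2)
    (hc : q.Coprime c) : ∃ a : ℕ, a ≡ 1 [MOD c] ∧ J(a | q) = -1 := by
  obtain ⟨n, hn⟩ := exists_jacobiSym_eq_neg_one hq hq2
  obtain ⟨a, ha1, ha2⟩ := Nat.chineseRemainder hc n 1
  refine ⟨a, ha2, ?_⟩
  rw [← hn]
  exact jacobiSym.mod_left' (by exact_mod_cast ha1)

theorem sum_range_two_mul_of_reflect {b : ℕ} {F : ℕ → ℝ} (h0 : F 0 = 0) (hb : F b = 0)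
    (h : ∀ j ≤ b, F (b + j) = F (b - j)) :
    ∑ j ∈ Finset.range (2 * b), F j = 2 * ∑ j ∈ Finset.range b, F j := by
  rw [two_mul b, Finset.sum_range_add, two_mul]
  congr 1
  rw [Finset.sum_congr rfl fun j hj => h j (Finset.mem_range.mp hj).le]
  have h1 := Finset.sum_range_reflect (fun j => F (j + 1)) b
  have h2 : ∀ j ∈ Finset.range b, F (b - j) = F (b - 1 - j + 1) := fun j hj => by
    have := Finset.mem_range.mp hj
    congr 1; omega
  rw [Finset.sum_congr rfl h2, h1]
  have h3 := Finset.sum_range_succ F b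
  rw [Finset.sum_range_succ', h0, hb] at h3
  linarith

theorem sum_range_odd_of_reflect {h : ℕ} {F : ℕ → ℝ} (h0 : F 0 = 0)
    (hF : ∀ j ≤ 2 * h + 1, F (2 * h + 1 - j) = F j) :
    ∑ j ∈ Finset.range (2 * h + 1), F j = 2 * ∑ j ∈ Finset.range (h + 1), F j := by
  rw [show 2 * h + 1 = (h + 1) + h by ring, Finset.sum_range_add, two_mul]
  congr 1
  have h1 := Finset.sum_range_reflect (fun j => F (j + 1)) h
  have h2 : ∀ j ∈ Finset.range h, F (h + 1 + j) = F (h - 1 - j + 1) := fun j hj => by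
    have := Finset.mem_range.mp hj
    rw [← hF (h + 1 + j) (by omega)]
    congr 1; omega
  rw [Finset.sum_congr rfl h2, h1, Finset.sum_range_succ', h0, add_zero]

theorem sin_odd_nat_mul_pi_sub {k : ℕ} (hk : Odd k) (x : ℝ) :
    Real.sin (k * Real.pi - x) = Real.sin x := by
  obtain ⟨l, rfl⟩ := hk
  have : ((2 * l + 1 : ℕ) : ℝ) * Real.pi - x = (Real.pi - x) + l * (2 * Real.pi) := by
    push_cast; ring
  rw [this, Real.sin_add_nat_mul_two_pi, Real.sin_pi_sub]

/-! ### The character modulo 4b, for b not congruent to 3 modulo 4 -/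

/-- The character `l ↦ (-b / l)` on odd `l`, extended by `0` to even `l`. -/
def oddJacobi (b l : ℕ) : ℤ := if Odd l then J(-b | l) else 0

theorem oddJacobi_of_odd (b : ℕ) {l : ℕ} (hl : Odd l) : oddJacobi b l = J(-b | l) := if_pos hl

theorem oddJacobi_mod (b l : ℕ) : oddJacobi b (l % (4 * b)) = oddJacobi b l := by
  have hiff : Odd (l % (4 * b)) ↔ Odd l := by
    rw [Nat.odd_iff, Nat.odd_iff, Nat.mod_mod_of_dvd _ ⟨2 * b, by ring⟩]
  unfold oddJacobi
  by_cases hl : Odd l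
  · rw [if_pos hl, if_pos (hiff.mpr hl), jacobiSym.mod_right _ hl, Int.natAbs_neg,
      Int.natAbs_natCast]
  · rw [if_neg hl, if_neg (mt hiff.mp hl)]

theorem oddJacobi_mul (b k l : ℕ) : oddJacobi b (k * l) = oddJacobi b k * oddJacobi b l := by
  unfold oddJacobi
  by_cases hk : Odd k
  · by_cases hl : Odd l
    · rw [if_pos hk, if_pos hl, if_pos (hk.mul hl), jacobiSym.mul_right' _ hk.pos.ne' hl.pos.ne']
    · rw [if_neg hl, if_neg (fun h => hl (Nat.odd_mul.mp h).2), mul_zero]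
  · rw [if_neg hk, if_neg (fun h => hk (Nat.odd_mul.mp h).1), zero_mul]

theorem oddJacobi_eq_zero {b l : ℕ} (h : ¬ l.Coprime (4 * b)) : oddJacobi b l = 0 := by
  unfold oddJacobi
  split_ifs with hl
  · rw [jacobiSym.eq_zero_iff]
    refine ⟨hl.pos.ne', fun hg => h ?_⟩
    rw [Int.neg_gcd] at hg
    have h2 : l.Coprime 2 := (Nat.coprime_two_right).mpr hl
    exact Nat.Coprime.mul_right (Nat.Coprime.pow_right 2 h2) (Nat.Coprime.symm hg)
  · rfl

theorem oddJacobi_trichotomy (b l : ℕ) :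
    oddJacobi b l = 0 ∨ oddJacobi b l = 1 ∨ oddJacobi b l = -1 := by
  unfold oddJacobi
  split_ifs
  · exact jacobiSym.trichotomy _ _
  · exact Or.inl rfl

theorem oddJacobi_sub_one {b : ℕ} (hb : 0 < b) : oddJacobi b (4 * b - 1) = -1 := by
  have hodd : Odd (4 * b - 1) := Nat.odd_iff.mpr (by omega)
  rw [oddJacobi_of_odd _ hodd, jacobiSym.neg _ hodd, ZMod.χ₄_nat_three_mod_four (by omega)]
  -- Since 4b is 1 modulo 4b - 1 and 4 is a square, (b/(4b-1)) = 1.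
  have h1 : J((4 * b : ℤ) | 4 * b - 1) = 1 := by
    rw [← jacobiSym.one_left (4 * b - 1)]
    apply jacobiSym.mod_left'
    rw [Int.emod_eq_emod_iff_emod_sub_eq_zero, Nat.cast_sub (by omega)]
    push_cast
    exact Int.emod_self
  rw [jacobiSym.mul_left, jacobiSym.at_four hodd, one_mul] at h1
  rw [h1]; norm_num

/-- This is primitivity at the prime 2. It fails for b ≡ 3 modulo 4, where the value is +1 and the
conductor is smaller; hence the separate treatment of that case. -/
theorem oddJacobi_one_add {b : ℕ} (hb : Squarefree b) (hb4 : b % 4 ≠ 3) :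
    oddJacobi b (1 + 2 * b) = -1 := by
  have hodd : Odd (1 + 2 * b) := Nat.odd_iff.mpr (by omega)
  have h0 : b % 4 ≠ 0 := fun h => by
    have := hb 2 (Nat.dvd_of_mod_eq_zero h)
    norm_num at this
  rw [oddJacobi_of_odd _ hodd]
  rcases (by omega : b % 4 = 1 ∨ b % 4 = 2) with h | h
  · rw [jacobiSym.neg _ hodd, ZMod.χ₄_nat_three_mod_four (by omega),
      jacobiSym.quadratic_reciprocity_one_mod_four h hodd]
    have : J(((1 + 2 * b : ℕ) : ℤ) | b) = 1 := by
      rw [← jacobiSym.one_left b]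
      apply jacobiSym.mod_left'
      push_cast
      exact Int.add_mul_emod_self_right _ _ _
    rw [this]; norm_num
  · obtain ⟨c, rfl⟩ : ∃ c, b = 2 * c := ⟨b / 2, by omega⟩
    have h1 : J(-c | 1 + 2 * (2 * c)) = 1 := by
      apply jacobiSym_neg_eq_one_of_modEq_one
      rw [show 1 + 2 * (2 * c) = 1 + 4 * c by ring]
      exact Nat.add_mod_right _ _
    have h2 : J(2 | 1 + 2 * (2 * c)) = -1 := by
      rw [jacobiSym.at_two hodd, ZMod.χ₈_nat_eq_if_mod_eight]
      have : (1 + 2 * (2 * c)) % 8 = 5 := by omega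
      rw [this]
      rw [if_neg (by omega)]
      simp
    have h3 : (-((2 * c : ℕ) : ℤ)) = 2 * (-c) := by push_cast; ring
    rw [h3, jacobiSym.mul_left, h1, h2]; norm_num

/-- For odd q the Chinese remainder theorem gives a ≡ 1 modulo 4b/q that is a non-residue modulo q.
As a ≡ 1 modulo 4, reciprocity transfers this to (q/a). -/
theorem exists_oddJacobi_eq_neg_one {b : ℕ} (hb : Squarefree b) (hb4 : b % 4 ≠ 3) {q : ℕ}
    (hq : q.Prime) (hqb : q ∣ 4 * b) : ∃ a : ℕ, a ≡ 1 [MOD 4 * b / q] ∧ oddJacobi b a = -1 := by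
  rcases eq_or_ne q 2 with rfl | hq2
  · refine ⟨1 + 2 * b, ?_, oddJacobi_one_add hb hb4⟩
    rw [show 4 * b / 2 = 2 * b by omega]
    exact Nat.add_mod_right _ _
  have hcop2 : q.Coprime 4 := by
    rw [show 4 = 2 ^ 2 by norm_num]
    exact Nat.Coprime.pow_right 2 ((Nat.coprime_primes hq Nat.prime_two).mpr hq2)
  obtain ⟨c, rfl⟩ := hcop2.dvd_of_dvd_mul_left hqb
  have hqc : q.Coprime c := Nat.coprime_of_squarefree_mul hb
  obtain ⟨a, ha, haq⟩ := modEq_and_jacobiSym_eq_neg_one hq hq2 (hcop2.mul_right hqc)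
  have h4 : a % 4 = 1 := (Nat.ModEq.of_mul_right c ha)
  have hodd : Odd a := Nat.odd_iff.mpr (by omega)
  refine ⟨a, ?_, ?_⟩
  · rwa [show 4 * (q * c) = q * (4 * c) by ring, Nat.mul_div_cancel_left _ hq.pos]
  · rw [oddJacobi_of_odd _ hodd]
    have h3 : (-((q * c : ℕ) : ℤ)) = q * (-c) := by push_cast; ring
    rw [h3, jacobiSym.mul_left, jacobiSym_neg_eq_one_of_modEq_one ha, mul_one,
      jacobiSym.quadratic_reciprocity_one_mod_four' (hq.odd_of_ne_two hq2) h4, haq]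

/-- For odd k the summand of the Gauss sum modulo 4b is invariant under j ↦ j + 2b and j ↦ 2b - j,
so the full period is four copies of the range below b. -/
theorem exists_sign_jacobiSym_eq_sum_of_ne_three {b : ℕ} (hb : Squarefree b) (hb4 : b % 4 ≠ 3)
    (hb1 : 1 < b) : ∃ σ : ℤˣ, ∀ k : ℕ, Odd k →
      (J(-b | k) : ℝ) = 2 / √(b : ℝ) * ∑ p ∈ Finset.range b,
        (((σ : ℤ) * oddJacobi b p : ℤ) : ℝ) * Real.sin (k * (p * Real.pi / (2 * b))) := by
  have hb0 : (0 : ℝ) < b := by exact_mod_cast (by omega : 0 < b)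
  have : NeZero (4 * b) := ⟨by omega⟩
  obtain ⟨σ, hσ⟩ := exists_sign_sum_quadratic_mul_sin (N := 4 * b) (oddJacobi b) (oddJacobi_mod b)
    (by rw [oddJacobi_of_odd b odd_one, jacobiSym.one_right]) (oddJacobi_mul b)
    (fun l => oddJacobi_eq_zero) (oddJacobi_trichotomy b) (oddJacobi_sub_one (by omega))
    (fun q hq hqb => exists_oddJacobi_eq_neg_one hb hb4 hq hqb)
  refine ⟨σ, fun k hk => ?_⟩
  let F : ℕ → ℝ := fun j => (oddJacobi b j : ℝ) * Real.sin (k * (j * Real.pi / (2 * b)))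
  have hzero : ∀ j, ¬ j.Coprime (4 * b) → F j = 0 := fun j hj => by
    simp only [F, oddJacobi_eq_zero hj]; simp
  have h0 : F 0 = 0 := by simp [F]
  have hodd0 : ∀ j, Even j → F j = 0 := fun j hj => by
    simp only [F, oddJacobi, if_neg (Nat.not_odd_iff_even.mpr hj)]; simp
  have hgadd : ∀ j, Odd j → oddJacobi b (2 * b + j) = -oddJacobi b j := fun j hj => by
    obtain ⟨i, rfl⟩ := hj
    -- For odd j, j(1 + 2b) ≡ j + 2b modulo 4b.
    have h1 := oddJacobi_mul b (2 * i + 1) (1 + 2 * b)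
    rw [oddJacobi_one_add hb hb4] at h1
    rw [← mul_neg_one, ← h1, ← oddJacobi_mod b (2 * b + _), ← oddJacobi_mod b (_ * _)]
    congr 1
    rw [show (2 * i + 1) * (1 + 2 * b) = (2 * b + (2 * i + 1)) + 4 * b * i by ring]
    exact (Nat.add_mul_mod_self_left _ _ _).symm
  have hgsub : ∀ j, j ≤ 4 * b → oddJacobi b (4 * b - j) = -oddJacobi b j := fun j hj => by
    rw [← neg_one_mul, ← oddJacobi_sub_one (b := b) (by omega), ← oddJacobi_mul,
      ← oddJacobi_mod b (_ - j), ← oddJacobi_mod b (_ * _)]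
    congr 1
    apply (Nat.ModEq.add_right_cancel' j)
    rw [Nat.sub_add_cancel hj]
    have : (4 * b - 1) * j + j = 4 * b * j := by
      rw [← Nat.succ_mul]; congr 1; omega
    rw [this]
    exact ((Nat.modEq_zero_iff_dvd.mpr (dvd_refl _)).trans
      (Nat.modEq_zero_iff_dvd.mpr (dvd_mul_right _ _)).symm)
  have hFadd : ∀ j, F (2 * b + j) = F j := fun j => by
    rcases Nat.even_or_odd j with hj | hj
    · rw [hodd0 _ hj, hodd0 _ ((even_two_mul b).add hj)]
    · simp only [F, hgadd j hj]
      have : (k : ℝ) * (((2 * b + j : ℕ) : ℝ) * Real.pi / (2 * b)) =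
          k * Real.pi - -(k * (j * Real.pi / (2 * b))) := by
        push_cast; field_simp; ring
      rw [this, sin_odd_nat_mul_pi_sub hk, Real.sin_neg]
      push_cast; ring
  have hFrefl : ∀ j ≤ 2 * b, F (2 * b - j) = F j := fun j hj => by
    rcases Nat.even_or_odd j with hj' | hj'
    · rw [hodd0 _ hj', hodd0 _ (by rw [Nat.even_sub hj]; simp [hj'])]
    · have e1 : oddJacobi b (2 * b - j) = oddJacobi b j := by
        rw [show 2 * b - j = 4 * b - (2 * b + j) by omega, hgsub _ (by omega), hgadd j hj', neg_neg]
      simp only [F, e1]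
      have : (k : ℝ) * (((2 * b - j : ℕ) : ℝ) * Real.pi / (2 * b)) =
          k * Real.pi - (k * (j * Real.pi / (2 * b))) := by
        rw [Nat.cast_sub hj]; push_cast; field_simp
      rw [this, sin_odd_nat_mul_pi_sub hk]
  -- The fixed point j = b of the reflection drops out because b > 1. For b = 1 it is the only term
  -- and is not doubled, whence K_1 = 1/2.
  have hFb : F b = 0 := hzero b (by
    rw [Nat.coprime_mul_iff_right, Nat.coprime_self]; omega)
  have hsum : ∑ j ∈ Finset.range (4 * b), F j = 4 * ∑ j ∈ Finset.range b, F j := by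
    rw [show 4 * b = 2 * b + 2 * b by ring, Finset.sum_range_add]
    simp_rw [hFadd]
    rw [sum_range_two_mul_of_reflect h0 hFb fun j hj => by
      rw [← hFrefl (b - j) (by omega)]; congr 1; omega]
    ring
  have key := hσ k
  have hcongr : ∑ j ∈ Finset.range (4 * b), (oddJacobi b j : ℝ) *
      Real.sin (2 * Real.pi * (j * k) / ((4 * b : ℕ) : ℝ)) = ∑ j ∈ Finset.range (4 * b), F j :=
    Finset.sum_congr rfl fun j _ => by
      simp only [F]; congr 2; push_cast; field_simp; ring
  rw [hcongr, hsum, oddJacobi_of_odd b hk] at key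
  have hsq4 : √(((4 * b : ℕ) : ℝ)) = 2 * √(b : ℝ) := by
    push_cast
    rw [Real.sqrt_mul (by norm_num), show (4 : ℝ) = 2 ^ 2 by norm_num,
      Real.sqrt_sq (by norm_num)]
  rw [hsq4] at key
  have hσ2 : (((σ : ℤ) : ℝ)) * ((σ : ℤ) : ℝ) = 1 := by
    rcases Int.units_eq_one_or σ with rfl | rfl <;> norm_num
  have hsqrt : √(b : ℝ) ≠ 0 := (Real.sqrt_pos.mpr hb0).ne'
  have hpull : ∑ p ∈ Finset.range b, (((σ : ℤ) * oddJacobi b p : ℤ) : ℝ) *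
      Real.sin (k * (p * Real.pi / (2 * b))) = ((σ : ℤ) : ℝ) * ∑ j ∈ Finset.range b, F j := by
    rw [Finset.mul_sum]
    refine Finset.sum_congr rfl fun p _ => ?_
    simp only [F]; push_cast; ring
  rw [hpull]
  field_simp
  linear_combination (-(J(-b | k) : ℝ) * √(b : ℝ)) * hσ2 - ((σ : ℤ) : ℝ) / 2 * key

/-! ### The character modulo b, for b congruent to 3 modulo 4 -/

theorem jacobiSym_neg_left_eq_of_three_mod_four {b k : ℕ} (hb : b % 4 = 3) (hk : Odd k) :
    J(-b | k) = J(k | b) := by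
  have hbo : Odd b := Nat.odd_iff.mpr (by omega)
  rw [jacobiSym.neg _ hk]
  rcases (by have := Nat.odd_iff.mp hk; omega : k % 4 = 1 ∨ k % 4 = 3) with h | h
  · rw [ZMod.χ₄_nat_one_mod_four h, one_mul, jacobiSym.quadratic_reciprocity_one_mod_four' hbo h]
  · rw [ZMod.χ₄_nat_three_mod_four h, jacobiSym.quadratic_reciprocity_three_mod_four hb h]
    ring

/-- For `b ≡ 3 mod 4` and `0 ≤ j ≤ (b - 1) / 2`, the index `p ≤ b` such that
`sin (2 π j k / b) = sin (p π k / (2 b))` for all odd `k`. -/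
def foldIndex (b j : ℕ) : ℕ := if 4 * j ≤ b then 4 * j else 2 * b - 4 * j

/-- The quadratic residue symbol modulo `b`, transported along `foldIndex`. -/
def foldedJacobi (b p : ℕ) : ℤ :=
  if p % 4 = 0 then J((p / 4 : ℕ) | b) else if p % 4 = 2 then J(((2 * b - p) / 4 : ℕ) | b) else 0

theorem foldedJacobi_foldIndex {b j : ℕ} (hb : b % 4 = 3) (hj : j < b / 2 + 1) :
    foldedJacobi b (foldIndex b j) = J(j | b) := by
  unfold foldedJacobi foldIndex
  split_ifs with h1 h2 h3 h4 h5
  · congr 2; omega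
  · omega
  · omega
  · omega
  · congr 2; omega
  · omega

/-- The angle 2πjk/b is k(4j)π/(2b); when 4j > b, the reflection x ↦ kπ - x replaces 4j by 2b - 4j.
The two cases are told apart by the residue of p modulo 4, b being odd. -/
theorem sum_foldedJacobi {b : ℕ} (hb : b % 4 = 3) {k : ℕ} (hk : Odd k) :
    ∑ j ∈ Finset.range (b / 2 + 1), (J(j | b) : ℝ) * Real.sin (2 * Real.pi * (j * k) / b) =
      ∑ p ∈ Finset.range b, (foldedJacobi b p : ℝ) * Real.sin (k * (p * Real.pi / (2 * b))) := by
  have hb0 : (b : ℝ) ≠ 0 := by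
    have : b ≠ 0 := by rintro rfl; simp at hb
    exact_mod_cast this
  refine Finset.sum_of_injOn (foldIndex b) ?_ ?_ ?_ ?_
  · intro i hi j hj hij
    simp only [Finset.coe_range, Set.mem_Iio] at hi hj
    unfold foldIndex at hij
    split_ifs at hij <;> omega
  · intro j hj
    simp only [Finset.coe_range, Set.mem_Iio] at hj ⊢
    unfold foldIndex
    split_ifs <;> omega
  · intro p hp hnot
    have hp' := Finset.mem_range.mp hp
    suffices foldedJacobi b p = 0 by rw [this]; simp
    unfold foldedJacobi
    split_ifs with h1 h2
    · exfalso
      refine hnot ⟨p / 4, ?_, ?_⟩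
      · simp only [Finset.coe_range, Set.mem_Iio]; omega
      · unfold foldIndex
        rw [if_pos (by omega)]; omega
    · exfalso
      refine hnot ⟨(2 * b - p) / 4, ?_, ?_⟩
      · simp only [Finset.coe_range, Set.mem_Iio]; omega
      · unfold foldIndex
        rw [if_neg (by omega)]; omega
    · rfl
  · intro j hj
    have hj' := Finset.mem_range.mp hj
    rw [foldedJacobi_foldIndex hb hj']
    congr 1
    unfold foldIndex
    split_ifs with h
    · congr 1; push_cast; field_simp; ring
    · rw [← sin_odd_nat_mul_pi_sub hk]
      congr 1
      rw [Nat.cast_sub (by omega)]; push_cast; field_simp; ring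

/-- By reciprocity (-b/k) = (k/b), an odd primitive character modulo b. Its Gauss sum is halved by j
↦ b - j and then reindexed by `foldIndex`. -/
theorem exists_sign_jacobiSym_eq_sum_of_three {b : ℕ} (hb : Squarefree b) (hb4 : b % 4 = 3) :
    ∃ σ : ℤˣ, ∀ k : ℕ, Odd k →
      (J(-b | k) : ℝ) = 2 / √(b : ℝ) * ∑ p ∈ Finset.range b,
        (((σ : ℤ) * foldedJacobi b p : ℤ) : ℝ) * Real.sin (k * (p * Real.pi / (2 * b))) := by
  have hb0 : (0 : ℝ) < b := by exact_mod_cast (by omega : 0 < b)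
  have : NeZero b := ⟨by omega⟩
  let g : ℕ → ℤ := fun l => J(l | b)
  have hper : ∀ l, g (l % b) = g l := fun l => by
    simp only [g]; rw [jacobiSym.mod_left l]; push_cast; rfl
  have hmul : ∀ k l, g (k * l) = g k * g l := fun k l => by
    simp only [g]; rw [← jacobiSym.mul_left]; push_cast; rfl
  have hneg : g (b - 1) = -1 := by
    have h1 : g (b - 1) = J(-1 | b) := by
      apply jacobiSym.mod_left'
      rw [Nat.cast_sub (by omega)]
      push_cast
      rw [sub_eq_add_neg, add_comm]
      exact Int.add_emod_right _ _
    rw [h1, jacobiSym.at_neg_one (Nat.odd_iff.mpr (by omega)), ZMod.χ₄_nat_three_mod_four hb4]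
  obtain ⟨σ, hσ⟩ := exists_sign_sum_quadratic_mul_sin (N := b) g hper
    (by simp [g]) hmul
    (fun l hl => jacobiSym.eq_zero_iff_not_coprime.mpr (by simpa using hl))
    (fun l => jacobiSym.trichotomy _ _) hneg (fun q hq hqb => by
      obtain ⟨c, rfl⟩ := hqb
      have hqc : q.Coprime c := Nat.coprime_of_squarefree_mul hb
      have hq2 : q ≠ 2 := by rintro rfl; omega
      obtain ⟨a, ha, haq⟩ := modEq_and_jacobiSym_eq_neg_one hq hq2 hqc
      have hc0 : c ≠ 0 := by rintro rfl; simp at hb4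
      refine ⟨a, by rwa [Nat.mul_div_cancel_left _ hq.pos], ?_⟩
      have h1 : J(a | c) = 1 := by
        rw [← jacobiSym.one_left c]
        exact jacobiSym.mod_left' (by exact_mod_cast ha)
      simp only [g]
      rw [jacobiSym.mul_right' _ hq.ne_zero hc0, haq, h1]; norm_num)
  refine ⟨σ, fun k hk => ?_⟩
  have key := hσ k
  obtain ⟨h, hbh⟩ : ∃ h, b = 2 * h + 1 := ⟨b / 2, by omega⟩
  have hrefl : ∑ j ∈ Finset.range b, (g j : ℝ) * Real.sin (2 * Real.pi * (j * k) / b) =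
      2 * ∑ j ∈ Finset.range (b / 2 + 1), (g j : ℝ) * Real.sin (2 * Real.pi * (j * k) / b) := by
    have := sum_range_odd_of_reflect (h := h)
      (F := fun j => (g j : ℝ) * Real.sin (2 * Real.pi * (j * k) / b)) (by simp) (fun j hj => by
        rw [← hbh] at hj ⊢
        have e1 : g (b - j) = -g j := by
          rw [← neg_one_mul, ← hneg, ← hmul, ← hper (b - j), ← hper (_ * _)]
          congr 1
          apply (Nat.ModEq.add_right_cancel' j)
          rw [Nat.sub_add_cancel hj]
          have : (b - 1) * j + j = b * j := by rw [← Nat.succ_mul]; congr 1; omega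
          rw [this]
          exact ((Nat.modEq_zero_iff_dvd.mpr (dvd_refl _)).trans
            (Nat.modEq_zero_iff_dvd.mpr (dvd_mul_right _ _)).symm)
        have e2 : 2 * Real.pi * (((b - j : ℕ) : ℝ) * k) / b =
            k * (2 * Real.pi) - 2 * Real.pi * (j * k) / b := by
          rw [Nat.cast_sub hj]; field_simp
        rw [e1, e2, Real.sin_nat_mul_two_pi_sub]
        push_cast; ring)
    rw [← hbh, show h + 1 = b / 2 + 1 by omega] at this
    exact this
  rw [hrefl, sum_foldedJacobi hb4 hk] at key
  have hσ2 : (((σ : ℤ) : ℝ)) * ((σ : ℤ) : ℝ) = 1 := by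
    rcases Int.units_eq_one_or σ with rfl | rfl <;> norm_num
  have hsqrt : √(b : ℝ) ≠ 0 := (Real.sqrt_pos.mpr hb0).ne'
  have hpull : ∑ p ∈ Finset.range b, (((σ : ℤ) * foldedJacobi b p : ℤ) : ℝ) *
      Real.sin (k * (p * Real.pi / (2 * b))) = ((σ : ℤ) : ℝ) * ∑ p ∈ Finset.range b,
      (foldedJacobi b p : ℝ) * Real.sin (k * (p * Real.pi / (2 * b))) := by
    rw [Finset.mul_sum]
    refine Finset.sum_congr rfl fun p _ => ?_
    push_cast; ring
  have hgk : g k = J(-b | k) := (jacobiSym_neg_left_eq_of_three_mod_four hb4 hk).symm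
  rw [hgk] at key
  rw [hpull]
  generalize ∑ p ∈ Finset.range b,
    (foldedJacobi b p : ℝ) * Real.sin (k * (p * Real.pi / (2 * b))) = S at key ⊢
  field_simp
  linear_combination (-(J(-b | k) : ℝ) * √(b : ℝ)) * hσ2 - ((σ : ℤ) : ℝ) * key

theorem foldedJacobi_trichotomy (b p : ℕ) :
    foldedJacobi b p = 0 ∨ foldedJacobi b p = 1 ∨ foldedJacobi b p = -1 := by
  unfold foldedJacobi
  split_ifs
  · exact jacobiSym.trichotomy _ _
  · exact jacobiSym.trichotomy _ _
  · exact Or.inl rfl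

/-- The quadratic Gauss sum of `ℚ(√-b)`, folded to a sum of sines over `0 < p ≤ b`. -/
theorem exists_signs_jacobiSym_eq_sum_sin {b : ℕ} (hb : Squarefree b) :
    ∃ (P : Finset ℕ) (ε : ℕ → ℤˣ), (∀ p ∈ P, 0 < p ∧ p ≤ b) ∧ ∀ k : ℕ, Odd k →
      (J(-b | k) : ℝ) = 2 * K b / √(b : ℝ) * ∑ p ∈ P,
        ((ε p : ℤ) : ℝ) * Real.sin (k * (p * Real.pi / (2 * b))) := by
  have hb0 : 0 < b := Nat.pos_of_ne_zero hb.ne_zero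
  rcases eq_or_ne b 1 with rfl | hb1
  · refine ⟨{1}, fun _ => 1, by simp, fun k hk => ?_⟩
    have hsin : Real.sin (k * (Real.pi / 2)) = (ZMod.χ₄ (k : ZMod 4) : ℝ) := by
      rw [ZMod.χ₄_eq_neg_one_pow (Nat.odd_iff.mp hk)]
      obtain ⟨l, rfl⟩ := hk
      have h1 : ((2 * l + 1 : ℕ) : ℝ) * (Real.pi / 2) = Real.pi / 2 + l * Real.pi := by
        push_cast; ring
      rw [h1, Real.sin_add_nat_mul_pi, Real.sin_pi_div_two, show (2 * l + 1) / 2 = l by omega]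
      push_cast; ring
    have h2 : J(-(1 : ℕ) | k) = ZMod.χ₄ k := jacobiSym.at_neg_one hk
    rw [h2, ← hsin]
    simp [K]
  · obtain ⟨e, he3, he⟩ : ∃ e : ℕ → ℤ, (∀ p, e p = 0 ∨ e p = 1 ∨ e p = -1) ∧ ∀ k : ℕ, Odd k →
        (J(-b | k) : ℝ) = 2 / √(b : ℝ) * ∑ p ∈ Finset.range b,
          (e p : ℝ) * Real.sin (k * (p * Real.pi / (2 * b))) := by
      by_cases hb4 : b % 4 = 3
      · obtain ⟨σ, hσ⟩ := exists_sign_jacobiSym_eq_sum_of_three hb hb4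
        refine ⟨_, fun p => ?_, hσ⟩
        rcases Int.units_eq_one_or σ with rfl | rfl <;>
          rcases foldedJacobi_trichotomy b p with h | h | h <;> rw [h] <;> simp
      · obtain ⟨σ, hσ⟩ := exists_sign_jacobiSym_eq_sum_of_ne_three hb hb4 (by omega)
        refine ⟨_, fun p => ?_, hσ⟩
        rcases Int.units_eq_one_or σ with rfl | rfl <;>
          rcases oddJacobi_trichotomy b p with h | h | h <;> rw [h] <;> simp
    refine ⟨(Finset.range b).filter fun p => p ≠ 0 ∧ e p ≠ 0,
      fun p => if e p = 1 then 1 else -1, fun p hp => ?_, fun k hk => ?_⟩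
    · rw [Finset.mem_filter, Finset.mem_range] at hp
      exact ⟨Nat.pos_of_ne_zero hp.2.1, hp.1.le⟩
    · rw [he k hk, K, if_neg hb1, mul_one, Finset.sum_filter]
      congr 1
      refine Finset.sum_congr rfl fun p _ => ?_
      by_cases h1 : p ≠ 0 ∧ e p ≠ 0
      · rw [if_pos h1]
        rcases (he3 p).resolve_left h1.2 with h2 | h2 <;> simp [h2]
      · rw [if_neg h1]
        rw [not_and_or, not_not, not_not] at h1
        rcases h1 with h | h <;> rw [h] <;> simp

/-! ### Removing the square factor by Möbius inversion -/

open scoped ArithmeticFunction.Moebius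

theorem sum_moebius_divisors_filter_dvd {u : ℕ} (hu : u ≠ 0) (l : ℕ) :
    ∑ d ∈ u.divisors with d ∣ l, μ d = if u.Coprime l then 1 else 0 := by
  have hg : u.gcd l ≠ 0 := Nat.gcd_ne_zero_left hu
  have h1 : u.divisors.filter (· ∣ l) = (u.gcd l).divisors := by
    ext d
    simp only [Finset.mem_filter, Nat.mem_divisors, Nat.dvd_gcd_iff]
    tauto
  have h2 := congrArg (fun f : ArithmeticFunction ℤ => f (u.gcd l))
    ArithmeticFunction.coe_zeta_mul_moebius
  simp only [ArithmeticFunction.coe_zeta_mul_apply, ArithmeticFunction.one_apply] at h2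
  rw [h1, h2]

theorem jacobiSym_neg_mul_sq (a : ℤ) {u : ℕ} (hu : u ≠ 0) (l : ℕ) (hl : l ≠ 0) :
    J(-(a * (u : ℤ) ^ 2) | l) = ∑ d ∈ u.divisors with d ∣ l, μ d * J(-a | d) * J(-a | l / d) := by
  have h1 : ∀ d ∈ u.divisors.filter (· ∣ l), μ d * J(-a | d) * J(-a | l / d) = μ d * J(-a | l) := by
    intro d hd
    obtain ⟨c, rfl⟩ := (Finset.mem_filter.mp hd).2
    obtain ⟨hd0, hc0⟩ := mul_ne_zero_iff.mp hl
    rw [Nat.mul_div_cancel_left _ (Nat.pos_of_ne_zero hd0), jacobiSym.mul_right' _ hd0 hc0, mul_assoc]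
  rw [Finset.sum_congr rfl h1, ← Finset.sum_mul, sum_moebius_divisors_filter_dvd hu, ← neg_mul,
    jacobiSym.mul_left, jacobiSym.pow_left]
  split_ifs with h
  · rw [jacobiSym.sq_one (by simpa using h)]; ring
  · have h0 : J((u : ℤ) | l) = 0 := jacobiSym.eq_zero_iff.mpr ⟨hl, by simpa using h⟩
    rw [h0]; ring

/-- With d = 2e + 1, the odd number d(2k+1) has index dk + e, which is below N exactly when k < (N +
e)/d in integer division. -/
theorem sum_range_filter_dvd_odd {d : ℕ} (hd : Odd d) (N : ℕ) (f : ℕ → ℝ) :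
    ∑ k ∈ Finset.range N with d ∣ 2 * k + 1, f ((2 * k + 1) / d) =
      ∑ k ∈ Finset.range ((N + d / 2) / d), f (2 * k + 1) := by
  have hd0 := hd.pos
  obtain ⟨e, he⟩ := hd
  have hde : d / 2 = e := by omega
  symm
  refine Finset.sum_bij' (fun k _ => d * k + e) (fun k _ => ((2 * k + 1) / d) / 2) ?_ ?_ ?_ ?_ ?_
  · intro k hk
    have hk' := Finset.mem_range.mp hk
    rw [Nat.lt_iff_add_one_le, Nat.le_div_iff_mul_le hd0, hde] at hk'
    rw [Finset.mem_filter, Finset.mem_range]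
    refine ⟨by nlinarith, ⟨2 * k + 1, ?_⟩⟩
    rw [mul_add d, mul_one]
    nlinarith
  · intro k hk
    rw [Finset.mem_filter, Finset.mem_range] at hk
    obtain ⟨hk, c, hc⟩ := hk
    have hco : Odd c := (Nat.odd_mul.mp (hc ▸ odd_two_mul_add_one k)).2
    obtain ⟨i, rfl⟩ := hco
    rw [Finset.mem_range, hc, Nat.mul_div_cancel_left _ hd0, Nat.lt_iff_add_one_le,
      Nat.le_div_iff_mul_le hd0, hde, show (2 * i + 1) / 2 = i by omega]
    nlinarith
  · intro k hk
    have : 2 * (d * k + e) + 1 = d * (2 * k + 1) := by rw [mul_add d, mul_one]; nlinarith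
    simp only [this]
    rw [Nat.mul_div_cancel_left _ hd0]; omega
  · intro k hk
    rw [Finset.mem_filter, Finset.mem_range] at hk
    obtain ⟨hk, c, hc⟩ := hk
    have hco : Odd c := (Nat.odd_mul.mp (hc ▸ odd_two_mul_add_one k)).2
    obtain ⟨i, rfl⟩ := hco
    simp only [hc]
    rw [Nat.mul_div_cancel_left _ hd0, show (2 * i + 1) / 2 = i by omega]
    nlinarith
  · intro k hk
    have : 2 * (d * k + e) + 1 = d * (2 * k + 1) := by rw [mul_add d, mul_one]; nlinarith
    simp only [this]
    rw [Nat.mul_div_cancel_left _ hd0]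

/-- An exact identity of partial sums, so that no conditionally convergent series is rearranged at s
= 1. -/
theorem LPartial_mul_sq (a : ℤ) {u : ℕ} (hu : u ≠ 0) (s N : ℕ) :
    LPartial (a * (u : ℤ) ^ 2) s N = ∑ d ∈ u.divisors with Odd d,
      ((μ d * J(-a | d) : ℤ) : ℝ) / (d : ℝ) ^ s * LPartial a s ((N + d / 2) / d) := by
  have h1 : ∀ k ∈ Finset.range N,
      (J(-(a * (u : ℤ) ^ 2) | 2 * k + 1) : ℝ) / ((2 * k + 1 : ℕ) : ℝ) ^ s =
      ∑ d ∈ u.divisors with Odd d, if d ∣ 2 * k + 1 then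
        ((μ d * J(-a | d) : ℤ) : ℝ) / (d : ℝ) ^ s *
          ((J(-a | (2 * k + 1) / d) : ℝ) / (((2 * k + 1) / d : ℕ) : ℝ) ^ s) else 0 := by
    intro k _
    rw [jacobiSym_neg_mul_sq a hu _ (by omega), ← Finset.sum_filter, Finset.filter_filter]
    have hf : u.divisors.filter (fun d => Odd d ∧ d ∣ 2 * k + 1) =
        u.divisors.filter (· ∣ 2 * k + 1) := by
      refine Finset.filter_congr fun d _ => ⟨And.right, fun h => ⟨?_, h⟩⟩
      exact Odd.of_dvd_nat (odd_two_mul_add_one k) h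
    rw [hf, Int.cast_sum, Finset.sum_div]
    refine Finset.sum_congr rfl fun d hd => ?_
    obtain ⟨c, hc⟩ := (Finset.mem_filter.mp hd).2
    have hd0 : d ≠ 0 := by rintro rfl; simp at hc
    rw [hc, Nat.mul_div_cancel_left _ (Nat.pos_of_ne_zero hd0)]
    push_cast
    rw [mul_pow]
    rw [mul_div_mul_comm]
  unfold LPartial
  rw [Finset.sum_congr rfl h1, Finset.sum_comm]
  refine Finset.sum_congr rfl fun d hd => ?_
  rw [← Finset.sum_filter, ← Finset.mul_sum,
    sum_range_filter_dvd_odd (Finset.mem_filter.mp hd).2 N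
      (fun l => (J(-a | l) : ℝ) / (l : ℝ) ^ s)]

theorem tendsto_LPartial_mul_sq (a : ℤ) {u : ℕ} (hu : u ≠ 0) (s : ℕ) {ℓ : ℝ}
    (h : Tendsto (LPartial a s) atTop (𝓝 ℓ)) :
    Tendsto (LPartial (a * (u : ℤ) ^ 2) s) atTop
      (𝓝 (∑ d ∈ u.divisors with Odd d, ((μ d * J(-a | d) : ℤ) : ℝ) / (d : ℝ) ^ s * ℓ)) := by
  rw [funext (LPartial_mul_sq a hu s)]
  refine tendsto_finsetSum _ fun d hd => (h.comp ?_).const_mul _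
  have hd0 : 0 < d := (Finset.mem_filter.mp hd).2.pos
  refine tendsto_atTop_mono (fun N => Nat.div_le_div_right (Nat.le_add_right N (d / 2))) ?_
  exact Nat.tendsto_div_const_atTop hd0.ne'

/-! ### Generating functions of the L-values -/

theorem jacobiSym_left_eq_neg_one_pow_mul (b k : ℕ) :
    J(b | 2 * k + 1) = (-1) ^ k * J(-b | 2 * k + 1) := by
  have hodd := odd_two_mul_add_one k
  rw [jacobiSym.neg _ hodd, ZMod.χ₄_eq_neg_one_pow (Nat.odd_iff.mp hodd),
    show (2 * k + 1) / 2 = k by omega, ← mul_assoc, ← mul_pow]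
  norm_num

/-- The power series formed from the values `L_b(2n+1)` and `L_{-b}(2n+2)`, for `b` square-free. -/
theorem exists_L_powerSeries {b : ℕ} (hb : Squarefree b) :
    ∃ (P : Finset ℕ) (ε : ℕ → ℤˣ) (C D : ℕ → ℝ), (∀ p ∈ P, p ≤ b) ∧
      (∀ n, Tendsto (LPartial b (2 * n + 1)) atTop (𝓝 (C n))) ∧
      (∀ n, Tendsto (LPartial (-b) (2 * n + 2)) atTop (𝓝 (D n))) ∧
      ∀ z : ℝ, |z| < 1 →
        HasSum (fun n => C n * z ^ (2 * n)) (2 * K b / √(b : ℝ) * ∑ p ∈ P, ((ε p : ℤ) : ℝ) *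
          (Real.pi / 4 * (Real.cos (z * (Real.pi / 2 - p * Real.pi / (2 * b))) /
            Real.cos (Real.pi * z / 2)))) ∧
        HasSum (fun n => D n * z ^ (2 * n + 1)) (2 * K b / √(b : ℝ) * ∑ p ∈ P, ((ε p : ℤ) : ℝ) *
          (Real.pi / 4 * (Real.sin (z * (p * Real.pi / (2 * b))) /
            Real.cos (Real.pi * z / 2)))) := by
  obtain ⟨P, ε, hP, hJ⟩ := exists_signs_jacobiSym_eq_sum_sin hb
  have hb0 : (0 : ℝ) < b := by exact_mod_cast Nat.pos_of_ne_zero hb.ne_zero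
  have hπ := Real.pi_pos
  have hθ0 : ∀ p ∈ P, 0 < p * Real.pi / (2 * b) := fun p hp => by
    have : (0 : ℝ) < p := by exact_mod_cast (hP p hp).1
    positivity
  have hθ1 : ∀ p ∈ P, p * Real.pi / (2 * b) ≤ Real.pi / 2 := fun p hp => by
    have : (p : ℝ) ≤ b := by exact_mod_cast (hP p hp).2
    rw [div_le_div_iff₀ (by positivity) (by positivity)]
    nlinarith
  choose! S hS1 hS2 using fun p (hp : p ∈ P) =>
    exists_tendsto_sum_sin_odd_hasSum (hθ0 p hp) (hθ1 p hp)
  choose! R hR1 hR2 using fun p (hp : p ∈ P) =>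
    exists_hasSum_alternating_sin_odd (hθ0 p hp).le (hθ1 p hp)
  refine ⟨P, ε, fun n => 2 * K b / √(b : ℝ) * ∑ p ∈ P, ((ε p : ℤ) : ℝ) * S p n,
    fun n => 2 * K b / √(b : ℝ) * ∑ p ∈ P, ((ε p : ℤ) : ℝ) * R p n, fun p hp => (hP p hp).2,
    fun n => ?_, fun n => ?_, fun z hz => ⟨?_, ?_⟩⟩
  · refine Tendsto.congr (fun N => ?_) ((tendsto_finsetSum P fun p hp =>
      (hS1 p hp n).const_mul ((ε p : ℤ) : ℝ)).const_mul (2 * K b / √(b : ℝ)))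
    unfold LPartial
    simp_rw [Finset.mul_sum]
    rw [Finset.sum_comm]
    refine Finset.sum_congr rfl fun k _ => ?_
    rw [hJ _ (odd_two_mul_add_one k), Finset.mul_sum, Finset.sum_div]
    refine Finset.sum_congr rfl fun p _ => ?_
    push_cast; ring
  · refine Tendsto.congr (fun N => ?_) ((tendsto_finsetSum P fun p hp =>
      (hR1 p hp n).const_mul ((ε p : ℤ) : ℝ)).const_mul (2 * K b / √(b : ℝ)))
    unfold LPartial
    simp_rw [Finset.mul_sum]
    rw [Finset.sum_comm]
    refine Finset.sum_congr rfl fun k _ => ?_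
    rw [neg_neg, jacobiSym_left_eq_neg_one_pow_mul, Int.cast_mul, hJ _ (odd_two_mul_add_one k),
      Finset.mul_sum, Finset.mul_sum, Finset.sum_div]
    refine Finset.sum_congr rfl fun p _ => ?_
    push_cast; ring
  · have := (hasSum_sum fun p hp => (hS2 p hp z hz).mul_left ((ε p : ℤ) : ℝ)).mul_left
      (2 * K b / √(b : ℝ))
    refine this.congr_fun ?_
    intro n
    simp only [Finset.mul_sum, Finset.sum_mul]
    refine Finset.sum_congr rfl fun p _ => ?_
    ring
  · have := (hasSum_sum fun p hp => (hR2 p hp z hz).mul_left ((ε p : ℤ) : ℝ)).mul_left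
      (2 * K b / √(b : ℝ))
    refine this.congr_fun ?_
    intro n
    simp only [Finset.mul_sum, Finset.sum_mul]
    refine Finset.sum_congr rfl fun p _ => ?_
    ring

/-- The sign of a nonzero integer of absolute value one. -/
def unitOf (z : ℤ) : ℤˣ := if z = 1 then 1 else -1

theorem coe_unitOf {z : ℤ} (h : z = 1 ∨ z = -1) : ((unitOf z : ℤˣ) : ℤ) = z := by
  rcases h with rfl | rfl <;> simp [unitOf]

theorem moebius_mul_jacobiSym_eq_one_or {a : ℤ} {d : ℕ} (hd : Squarefree d) (h : a.gcd d = 1) :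
    μ d * J(a | d) = 1 ∨ μ d * J(a | d) = -1 := by
  rcases ArithmeticFunction.moebius_ne_zero_iff_eq_or.mp
    (ArithmeticFunction.moebius_ne_zero_iff_squarefree.mpr hd) with h1 | h1 <;>
  rcases jacobiSym.eq_one_or_neg_one h with h2 | h2 <;> rw [h1, h2] <;> norm_num

theorem moebius_mul_jacobiSym_eq_zero {a : ℤ} {d : ℕ} (hd0 : d ≠ 0)
    (h : ¬ (Squarefree d ∧ a.gcd d = 1)) : μ d * J(a | d) = 0 := by
  rw [not_and_or] at h
  rcases h with h | h
  · rw [ArithmeticFunction.moebius_eq_zero_of_not_squarefree h, zero_mul]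
  · rw [jacobiSym.eq_zero_iff.mpr ⟨hd0, h⟩, mul_zero]

/-- Even and odd terms are summed separately, as combinations over d of the square-free power series
at z = 2btx/π with t = u²/d. -/
theorem hasSum_sTerm {b u : ℕ} (hb : Squarefree b) (hu : 1 < u) :
    ∃ (P : Finset ℕ) (ε : ℕ → ℤˣ), (∀ p ∈ P, p ≤ b) ∧
      ∀ x : ℝ, |x| < Real.pi / (2 * ((b * u ^ 2 : ℕ) : ℝ)) →
        HasSum (sTerm (b * u ^ 2) x) (∑ d ∈ u.divisors with Odd d, ∑ p ∈ P,
          w b u (u ^ 2 / d) * sec ((b : ℝ) * (u ^ 2 / d : ℕ) * x) *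
            (((μ d * J(-b | d) * ε p : ℤ) : ℝ) *
                Real.cos (((b : ℝ) - p) * (u ^ 2 / d : ℕ) * x) +
              ((μ d * J(b | d) * ε p : ℤ) : ℝ) * Real.sin ((p : ℝ) * (u ^ 2 / d : ℕ) * x))) := by
  obtain ⟨P, ε, C, D, hP, hC, hD, hS⟩ := exists_L_powerSeries hb
  refine ⟨P, ε, hP, fun x hx => ?_⟩
  have hu0 : u ≠ 0 := by omega
  have hb0 : (0 : ℝ) < b := by exact_mod_cast Nat.pos_of_ne_zero hb.ne_zero
  have hu0' : (0 : ℝ) < u := by exact_mod_cast (by omega : 0 < u)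
  have hπ := Real.pi_pos
  have hπ0 := Real.pi_ne_zero
  have hm1 : b * u ^ 2 ≠ 1 := by
    intro h
    have h2 : 2 ^ 2 ≤ u ^ 2 := Nat.pow_le_pow_left hu 2
    have h3 := Nat.le_of_dvd one_pos (h ▸ dvd_mul_left (u ^ 2) b)
    omega
  have hKm : K (b * u ^ 2) = 1 := if_neg hm1
  have hsqrt : √(((b * u ^ 2 : ℕ) : ℝ)) = √(b : ℝ) * u := by
    push_cast
    rw [Real.sqrt_mul hb0.le, Real.sqrt_sq hu0'.le]
  have hsb : 0 < √(b : ℝ) := Real.sqrt_pos.mpr hb0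
  have hsb2 : √(b : ℝ) * √(b : ℝ) = b := Real.mul_self_sqrt hb0.le
  have hLC : ∀ n, L ((b * u ^ 2 : ℕ) : ℤ) (2 * n + 1) = ∑ d ∈ u.divisors with Odd d,
      ((μ d * J(-b | d) : ℤ) : ℝ) / (d : ℝ) ^ (2 * n + 1) * C n := fun n => by
    have := tendsto_LPartial_mul_sq (b : ℤ) hu0 _ (hC n)
    rw [L]
    push_cast at this ⊢
    exact this.limUnder_eq
  have hLD : ∀ n, L (-((b * u ^ 2 : ℕ) : ℤ)) (2 * n + 2) = ∑ d ∈ u.divisors with Odd d,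
      ((μ d * J(b | d) : ℤ) : ℝ) / (d : ℝ) ^ (2 * n + 2) * D n := fun n => by
    have := tendsto_LPartial_mul_sq (-(b : ℤ)) hu0 _ (hD n)
    rw [neg_neg] at this
    rw [L]
    push_cast at this ⊢
    rw [← neg_mul]
    exact this.limUnder_eq
  -- Chosen so that πz/2 = btx; since t ≤ u², the bound on x gives |z| < 1.
  let z : ℕ → ℝ := fun d => 2 * b * (u ^ 2 / d : ℕ) * x / Real.pi
  have ht : ∀ d ∈ u.divisors.filter Odd, ((u ^ 2 / d : ℕ) : ℝ) * d = (u : ℝ) ^ 2 ∧ (1 : ℝ) ≤ d := by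
    intro d hd
    have hd' := Finset.mem_filter.mp hd
    have hdu : d ∣ u ^ 2 := (Nat.dvd_of_mem_divisors hd'.1).trans (dvd_pow_self u two_ne_zero)
    exact ⟨by exact_mod_cast Nat.div_mul_cancel hdu, by exact_mod_cast hd'.2.pos⟩
  have hz : ∀ d ∈ u.divisors.filter Odd, |z d| < 1 := by
    intro d hd
    obtain ⟨h1, h2⟩ := ht d hd
    have h3 : ((u ^ 2 / d : ℕ) : ℝ) ≤ (u : ℝ) ^ 2 := by
      rw [← h1]; exact le_mul_of_one_le_right (Nat.cast_nonneg _) h2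
    rw [lt_div_iff₀ (by push_cast; positivity)] at hx
    push_cast at hx
    simp only [z]
    rw [abs_div, abs_of_pos hπ, div_lt_one hπ, abs_mul, abs_of_nonneg (by positivity)]
    refine lt_of_le_of_lt ?_ hx
    rw [mul_comm |x|, mul_assoc 2]
    gcongr
  have hcosarg : ∀ d, Real.pi * z d / 2 = b * (u ^ 2 / d : ℕ) * x := fun d => by
    simp only [z]; field_simp
  have heven : HasSum (fun n => sTerm (b * u ^ 2) x (2 * n)) (∑ d ∈ u.divisors with Odd d,
      ((μ d * J(-b | d) : ℤ) : ℝ) * (2 * b * (u ^ 2 / d : ℕ) / (Real.pi * (√(b : ℝ) * u))) *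
        (2 * K b / √(b : ℝ) * ∑ p ∈ P, ((ε p : ℤ) : ℝ) *
          (Real.pi / 4 * (Real.cos (z d * (Real.pi / 2 - p * Real.pi / (2 * b))) /
            Real.cos (Real.pi * z d / 2))))) := by
    have := hasSum_sum fun d hd => ((hS (z d) (hz d hd)).1).mul_left
      (((μ d * J(-b | d) : ℤ) : ℝ) * (2 * b * (u ^ 2 / d : ℕ) / (Real.pi * (√(b : ℝ) * u))))
    refine this.congr_fun fun n => ?_
    rw [sTerm, s, if_pos (even_two_mul n), c, hKm, hsqrt, one_mul,
      show 2 * n / 2 = n by omega, hLC]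
    simp only [Finset.mul_sum, Finset.sum_mul, Finset.sum_div]
    refine Finset.sum_congr rfl fun d hd => ?_
    obtain ⟨h1, h2⟩ := ht d hd
    have hd0 : (d : ℝ) ≠ 0 := by positivity
    have hfac : ((2 * n).factorial : ℝ) ≠ 0 := by exact_mod_cast Nat.factorial_ne_zero _
    -- The factor 1/d split off here cancels d^(2n+1) in the denominator of the Möbius sum.
    have e1 : Real.pi / (2 * ((b * u ^ 2 : ℕ) : ℝ)) =
        Real.pi / (2 * b * (u ^ 2 / d : ℕ)) / d := by
      push_cast; rw [← h1]; field_simp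
    rw [e1]
    simp only [z]
    have ht0 : ((u ^ 2 / d : ℕ) : ℝ) ≠ 0 := by
      intro h; rw [h, zero_mul] at h1; exact (by positivity : (u : ℝ) ^ 2 ≠ 0) h1.symm
    generalize ((u ^ 2 / d : ℕ) : ℝ) = t at *
    rw [div_pow, div_pow, div_pow, mul_pow _ x]
    field_simp
    ring
  have hodd : HasSum (fun n => sTerm (b * u ^ 2) x (2 * n + 1)) (∑ d ∈ u.divisors with Odd d,
      ((μ d * J(b | d) : ℤ) : ℝ) * (2 * b * (u ^ 2 / d : ℕ) / (Real.pi * (√(b : ℝ) * u))) *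
        (2 * K b / √(b : ℝ) * ∑ p ∈ P, ((ε p : ℤ) : ℝ) *
          (Real.pi / 4 * (Real.sin (z d * (p * Real.pi / (2 * b))) /
            Real.cos (Real.pi * z d / 2))))) := by
    have := hasSum_sum fun d hd => ((hS (z d) (hz d hd)).2).mul_left
      (((μ d * J(b | d) : ℤ) : ℝ) * (2 * b * (u ^ 2 / d : ℕ) / (Real.pi * (√(b : ℝ) * u))))
    refine this.congr_fun fun n => ?_
    rw [sTerm, s, if_neg (Nat.not_even_iff_odd.mpr (odd_two_mul_add_one n)), GenEulerClass.d, hKm,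
      hsqrt, one_mul, show (2 * n + 1 + 1) / 2 = n + 1 by omega, show 2 * (n + 1) = 2 * n + 2 by ring,
      show 2 * n + 2 - 1 = 2 * n + 1 by omega, hLD]
    simp only [Finset.mul_sum, Finset.sum_mul, Finset.sum_div]
    refine Finset.sum_congr rfl fun d hd => ?_
    obtain ⟨h1, h2⟩ := ht d hd
    have hd0 : (d : ℝ) ≠ 0 := by positivity
    have hfac : ((2 * n + 1).factorial : ℝ) ≠ 0 := by exact_mod_cast Nat.factorial_ne_zero _
    have e1 : Real.pi / (2 * ((b * u ^ 2 : ℕ) : ℝ)) =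
        Real.pi / (2 * b * (u ^ 2 / d : ℕ)) / d := by
      push_cast; rw [← h1]; field_simp
    rw [e1]
    simp only [z]
    have ht0 : ((u ^ 2 / d : ℕ) : ℝ) ≠ 0 := by
      intro h; rw [h, zero_mul] at h1; exact (by positivity : (u : ℝ) ^ 2 ≠ 0) h1.symm
    generalize ((u ^ 2 / d : ℕ) : ℝ) = t at *
    rw [div_pow, div_pow, div_pow, mul_pow _ x]
    field_simp
    ring
  convert! heven.even_add_odd hodd using 1
  rw [← Finset.sum_add_distrib]
  refine Finset.sum_congr rfl fun d hd => ?_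
  simp only [Finset.mul_sum]
  rw [← Finset.sum_add_distrib]
  refine Finset.sum_congr rfl fun p _ => ?_
  rw [hcosarg, w, sec]
  have e1 : z d * (Real.pi / 2 - p * Real.pi / (2 * b)) = ((b : ℝ) - p) * (u ^ 2 / d : ℕ) * x := by
    simp only [z]; field_simp
  have e2 : z d * (p * Real.pi / (2 * b)) = (p : ℝ) * (u ^ 2 / d : ℕ) * x := by
    simp only [z]; field_simp
  rw [e1, e2]
  -- The constants of the normalization, the Gauss sum and the Fourier series combine to the weight
  -- w(b,t).
  have e3 : (2 * b * ((u ^ 2 / d : ℕ) : ℝ) / (Real.pi * (√(b : ℝ) * u))) * (2 * K b / √(b : ℝ)) *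
      (Real.pi / 4) = K b * (u ^ 2 / d : ℕ) / u := by
    have hr := hsb.ne'
    generalize √(b : ℝ) = r at hsb2 hr ⊢
    field_simp
    linear_combination (-4 * K b * (u ^ 2 / d : ℕ)) * hsb2
  rw [← e3]
  push_cast
  ring

end GenEulerClass

open scoped ArithmeticFunction.Moebius in
theorem theorem3p1 (m b u : ℕ) (hm : m = b * u ^ 2) (hb : Squarefree b) (hu : 1 < u) :
    ∃ (T : Finset (ℕ × ℕ)) (ε δ : ℕ → ℕ → ℤˣ),
      (∀ t p : ℕ, (t, p) ∈ T → t ∣ u ^ 2 ∧ p ≤ b) ∧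
      ∀ x : ℝ, |x| < Real.pi / (2 * (m : ℝ)) →
        Summable (GenEulerClass.sTerm m x) ∧
        GenEulerClass.sGen m x =
          ∑ q ∈ T, GenEulerClass.term b u q.1 q.2 (ε q.1 q.2) (δ q.1 q.2) x := by
  subst hm
  obtain ⟨P, ε, hP, hsum⟩ := GenEulerClass.hasSum_sTerm hb hu
  have hu2 : u ^ 2 ≠ 0 := pow_ne_zero 2 (by omega)
  -- The odd divisors d of u for which μ(d)(±b/d) is nonzero, hence ±1.
  let E : Finset ℕ := u.divisors.filter fun d => Odd d ∧ Squarefree d ∧ b.Coprime d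
  have hdvd : ∀ d ∈ E, d ∣ u ^ 2 := fun d hd =>
    (Nat.dvd_of_mem_divisors (Finset.mem_filter.mp hd).1).trans (dvd_pow_self u two_ne_zero)
  have hinj : Set.InjOn (fun d => u ^ 2 / d) E := fun d hd e he hde => by
    have hde' : u ^ 2 / d = u ^ 2 / e := hde
    rw [← Nat.div_div_self (hdvd d hd) hu2, hde', Nat.div_div_self (hdvd e he) hu2]
  -- Distinct d give distinct t, and d is recovered as u²/t, so each pair (t, p) occurs once and its
  -- signs are functions of it.
  refine ⟨E.image (fun d => u ^ 2 / d) ×ˢ P,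
    fun t p => GenEulerClass.unitOf (μ (u ^ 2 / t) * J(-b | u ^ 2 / t)) * ε p,
    fun t p => GenEulerClass.unitOf (μ (u ^ 2 / t) * J(b | u ^ 2 / t)) * ε p, ?_, fun x hx => ?_⟩
  · intro t p htp
    rw [Finset.mem_product, Finset.mem_image] at htp
    obtain ⟨⟨d, hd, rfl⟩, hp⟩ := htp
    exact ⟨Nat.div_dvd_of_dvd (hdvd d hd), hP p hp⟩
  · have h := hsum x hx
    refine ⟨h.summable, ?_⟩
    rw [GenEulerClass.sGen, h.tsum_eq, Finset.sum_product, Finset.sum_image hinj]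
    have hsub : E ⊆ u.divisors.filter Odd := fun d hd => by
      have hd' := Finset.mem_filter.mp hd
      exact Finset.mem_filter.mpr ⟨hd'.1, hd'.2.1⟩
    rw [← Finset.sum_subset hsub]
    · refine Finset.sum_congr rfl fun d hd => Finset.sum_congr rfl fun p _ => ?_
      obtain ⟨-, -, hsq, hcop⟩ := Finset.mem_filter.mp hd
      simp only [GenEulerClass.term, Nat.div_div_self (hdvd d hd) hu2, Units.val_mul]
      rw [GenEulerClass.coe_unitOf
        (GenEulerClass.moebius_mul_jacobiSym_eq_one_or hsq (by simpa using hcop)),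
        GenEulerClass.coe_unitOf
        (GenEulerClass.moebius_mul_jacobiSym_eq_one_or hsq (by simpa using hcop))]
    · intro d hd hdE
      have hd' := Finset.mem_filter.mp hd
      have hnot : ¬ (Squarefree d ∧ b.Coprime d) := fun hh =>
        hdE (Finset.mem_filter.mpr ⟨hd'.1, hd'.2, hh⟩)
      refine Finset.sum_eq_zero fun p _ => ?_
      rw [GenEulerClass.moebius_mul_jacobiSym_eq_zero hd'.2.pos.ne' (by simpa using hnot),
        GenEulerClass.moebius_mul_jacobiSym_eq_zero hd'.2.pos.ne' (by simpa using hnot)]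
      simp
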